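/- \textbf{Theorem (Arbitrary approximate addition).} Let $\sigma_x,\sigma_z$ be the Pauli matrices. A single-qubit operator is \emph{embeddable} if it equals $e^{i\theta\sigma_x}$ for some $\theta\in[0,\pi]$, and \emph{twisted embeddable} if it equals $e^{i\varphi\sigma_z/2}e^{i\theta\sigma_x}e^{-i\varphi\sigma_z/2}$ for some $\theta\in[0,\pi]$, $\varphi\in[-\pi,\pi]$. An \emph{$(a,b)$ gadget} is a superoperator that maps every $a$-tuple of embeddable oracles $U_0,\dots,U_{a-1}$ to $b$ twisted embeddable unitaries $U'_0,\dots,U'_{b-1}$. It \emph{achieves} (respectively \emph{$\varepsilon$-approximately achieves}) functions $f_0,\dots,f_{b-1}$ on $D\subseteq[-1,1]^a$ if, for the oracles $U_j=e^{i\arccos(x_j)\sigma_x}$ and every $x\in D$ and $k$, one has $\langle 0|U'_k|0\rangle=f_k(x)$ (respectively $|\langle 0|U'_k|0\rangle-f_k(x)|\le\varepsilon$). A gadget is \emph{ancilla-free} if each output is a finite product, on one single qubit, of queries to the oracles $U_j$ and fixed single-qubit unitaries. For an ancilla-free gadget with one output, its \emph{cost} is the number of queries and its \emph{depth} is the number of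 all factors. There are an ancilla-free $(2,1)$ gadget $S$ that achieves $(T_4(x_0)+T_4(x_1))/2$ on $[-1,1]^2$, where $T_4$ is the fourth Chebyshev polynomial of the first kind, and an absolute constant $K>0$, such that for all $0<\delta\le 1$ and $0<\varepsilon\le 1/2$ the following holds. There is an ancilla-free $(1,1)$ gadget $R$ that $\varepsilon$-approximately achieves the right inverse $T_4^{-1}(x)=\cos(\arccos(x)/4)$ on $[-1+\delta,1-\delta]$, such that the circuit $G$ obtained by replacing, for $j=0,1$, each query of $S$ to the oracle $U_j$ by the circuit of $R$ run on $U_j$ is an ancilla-free $(2,1)$ gadget which $\varepsilon$-approximately achieves $$f(x_0,x_1)=\frac{x_0+x_1}{2}\qquad\text{on } [-1+\delta,1-\delta]^2,$$ and whose cost and depth are both at most $K\,\delta^{-1}\log\!\left(\varepsilon^{-2}\delta^{-1/4}\right)$. -/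

import Mathlib

open scoped Matrix

namespace QSPGadget

noncomputable section

/-- Linear operators on one qubit, in the computational basis `|0⟩, |1⟩`. -/
abbrev QubitOp : Type := Matrix (Fin 2) (Fin 2) ℂ

/-- The Pauli matrix `σ_x`. -/
def sigmaX : QubitOp := !![0, 1; 1, 0]

/-- The Pauli matrix `σ_z`. -/
def sigmaZ : QubitOp := !![1, 0; 0, -1]

/-- The rotation `e^{iθσ_x}`, in closed form; see `rotX_eq_exp`. -/
def rotX (θ : ℝ) : QubitOp :=
  !![(Real.cos θ : ℂ), Complex.I * (Real.sin θ : ℂ);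
     Complex.I * (Real.sin θ : ℂ), (Real.cos θ : ℂ)]

/-- The rotation `e^{iφσ_z}`, in closed form; see `rotZ_eq_exp`. -/
def rotZ (φ : ℝ) : QubitOp :=
  !![Complex.exp (Complex.I * (φ : ℂ)), 0; 0, Complex.exp (-(Complex.I * (φ : ℂ)))]

theorem rotZ_eq_exp (φ : ℝ) :
    rotZ φ = NormedSpace.exp ((Complex.I * (φ : ℂ)) • sigmaZ) := by
  have h : (Complex.I * (φ : ℂ)) • sigmaZ
      = Matrix.diagonal ![Complex.I * (φ : ℂ), -(Complex.I * (φ : ℂ))] := by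
    ext i j
    fin_cases i <;> fin_cases j <;> simp [sigmaZ]
  rw [h, Matrix.exp_diagonal]
  ext i j
  fin_cases i <;> fin_cases j <;> simp [rotZ, Pi.coe_exp, Complex.exp_eq_exp_ℂ]

theorem rotX_eq_exp (θ : ℝ) :
    rotX θ = NormedSpace.exp ((Complex.I * (θ : ℂ)) • sigmaX) := by
  have hP : IsUnit (!![1, 1; 1, -1] : QubitOp) := by
    rw [Matrix.isUnit_iff_isUnit_det, Matrix.det_fin_two_of]
    norm_num
  have hinv : (!![1, 1; 1, -1] : QubitOp)⁻¹ = !![1 / 2, 1 / 2; 1 / 2, -1 / 2] := by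
    apply Matrix.inv_eq_right_inv
    ext i j
    fin_cases i <;> fin_cases j <;> norm_num [Matrix.mul_apply, Fin.sum_univ_two]
  have h : (Complex.I * (θ : ℂ)) • sigmaX
      = (!![1, 1; 1, -1] : QubitOp) * ((Complex.I * (θ : ℂ)) • sigmaZ)
        * (!![1, 1; 1, -1] : QubitOp)⁻¹ := by
    rw [hinv]
    ext i j
    fin_cases i <;> fin_cases j <;>
      simp [sigmaX, sigmaZ, Matrix.mul_apply, Fin.sum_univ_two] <;> ring
  rw [h, Matrix.exp_conj _ _ hP, ← rotZ_eq_exp, hinv]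
  have e1 : Complex.exp (Complex.I * (θ : ℂ))
      = Complex.cos θ + Complex.sin θ * Complex.I := by
    rw [mul_comm, Complex.exp_mul_I]
  have e2 : Complex.exp (-(Complex.I * (θ : ℂ)))
      = Complex.cos θ - Complex.sin θ * Complex.I := by
    rw [show -(Complex.I * (θ : ℂ)) = (-(θ : ℂ)) * Complex.I by ring, Complex.exp_mul_I,
      Complex.cos_neg, Complex.sin_neg]
    ring
  ext i j
  fin_cases i <;> fin_cases j <;>
    simp [rotX, rotZ, Matrix.mul_apply, Fin.sum_univ_two, e1, e2] <;> ring

/-- `U` is embeddable: `U = e^{iθσ_x}` with `θ ∈ [0, π]`. -/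
def IsEmbeddable (U : QubitOp) : Prop :=
  ∃ θ ∈ Set.Icc 0 Real.pi, U = rotX θ

/-- `U` is twisted embeddable: `U = e^{iφσ_z/2} e^{iθσ_x} e^{-iφσ_z/2}` with `θ ∈ [0, π]` and
`φ ∈ [-π, π]`. -/
def IsTwistedEmbeddable (U : QubitOp) : Prop :=
  ∃ θ ∈ Set.Icc 0 Real.pi, ∃ φ ∈ Set.Icc (-Real.pi) Real.pi,
    U = rotZ (φ / 2) * rotX θ * rotZ (-φ / 2)

/-- A superoperator with `a` single-qubit inputs and `b` single-qubit outputs. -/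
abbrev SuperOp (a b : ℕ) : Type := (Fin a → QubitOp) → Fin b → QubitOp

/-- An `(a, b)` gadget is a superoperator that sends every tuple of `a` embeddable oracles to `b`
twisted embeddable unitaries. -/
def IsGadget {a b : ℕ} (G : SuperOp a b) : Prop :=
  ∀ U : Fin a → QubitOp, (∀ j, IsEmbeddable (U j)) → ∀ k, IsTwistedEmbeddable (G U k)

/-- The matrix element `⟨0|U'_k|0⟩` of the `k`-th output on the oracles `U_j = e^{iθ_jσ_x}` with
`θ_j = arccos x_j ∈ [0, π]`, as a function of `x ∈ [-1, 1]^a`. -/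
def achieved {a b : ℕ} (G : SuperOp a b) (x : Fin a → ℝ) (k : Fin b) : ℂ :=
  G (fun j => rotX (Real.arccos (x j))) k 0 0

/-- `G` achieves `F = (f_0, …, f_{b-1})` on the domain `D ⊆ [-1, 1]^a`. -/
def Achieves {a b : ℕ} (G : SuperOp a b) (F : (Fin a → ℝ) → Fin b → ℝ)
    (D : Set (Fin a → ℝ)) : Prop :=
  ∀ x ∈ D, ∀ k, achieved G x k = (F x k : ℂ)

/-- `G` `ε`-approximately achieves `F = (f_0, …, f_{b-1})` on the domain `D ⊆ [-1, 1]^a`. -/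
def ApproxAchieves {a b : ℕ} (ε : ℝ) (G : SuperOp a b) (F : (Fin a → ℝ) → Fin b → ℝ)
    (D : Set (Fin a → ℝ)) : Prop :=
  ∀ x ∈ D, ∀ k, ‖achieved G x k - (F x k : ℂ)‖ ≤ ε

/-- One step of a single-qubit circuit with access to `a` black-box oracles: a query to one of the
oracles, or a fixed unitary that does not depend on the oracles. -/
inductive Gate (a : ℕ) : Type
  | query (j : Fin a) : Gate a
  | fixed (W : Matrix.unitaryGroup (Fin 2) ℂ) : Gate a

/-- The operator applied by a gate when the oracles are `U`. -/
def Gate.eval {a : ℕ} (U : Fin a → QubitOp) : Gate a → QubitOp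
  | .query j => U j
  | .fixed W => (W : QubitOp)

/-- Whether a gate is a query to the oracle `j`. -/
def Gate.isQuery {a : ℕ} (j : Fin a) : Gate a → Bool
  | .query i => decide (i = j)
  | .fixed _ => false

/-- An ancilla-free circuit with `a` oracles and `b` outputs: each output is produced by a sequence
of gates on one single qubit, without further qubits and without measurement. -/
abbrev Circuit (a b : ℕ) : Type := Fin b → List (Gate a)

/-- The superoperator of a circuit; each output is the product of its gates, in list order. -/
def Circuit.toSuperOp {a b : ℕ} (C : Circuit a b) : SuperOp a b :=
  fun U k => ((C k).map (Gate.eval U)).prod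

/-- The cost matrix: the number of queries to oracle `j` used for output `k`. -/
def Circuit.costMatrix {a b : ℕ} (C : Circuit a b) (j : Fin a) (k : Fin b) : ℕ :=
  (C k).countP (Gate.isQuery j)

/-- The cost of output `k`: the total number of oracle queries used for it. -/
def Circuit.cost {a b : ℕ} (C : Circuit a b) (k : Fin b) : ℕ :=
  ∑ j, C.costMatrix j k

/-- The depth of output `k`: the number of all its gates, queries and fixed unitaries. -/
def Circuit.depth {a b : ℕ} (C : Circuit a b) (k : Fin b) : ℕ :=
  (C k).length

/-- Replace each query to oracle `j` of `S` by the circuit of the output `j` of `R`. -/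
def Circuit.comp {a c d : ℕ} (S : Circuit c d) (R : Circuit a c) : Circuit a d :=
  fun k => (S k).flatMap fun g =>
    match g with
    | .query j => R j
    | .fixed W => [.fixed W]

/-- `a` parallel copies of a one-input one-output circuit, the `j`-th one querying oracle `j`. -/
def Circuit.copies (a : ℕ) (R : Circuit 1 1) : Circuit a a :=
  fun j => (R 0).map fun g =>
    match g with
    | .query _ => .query j
    | .fixed W => .fixed W

/-- The cube `[-1 + δ, 1 - δ]^a`. -/
def cube (a : ℕ) (δ : ℝ) : Set (Fin a → ℝ) :=
  {x | ∀ j, x j ∈ Set.Icc (-1 + δ) (1 - δ)}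

/-- The value `T_4(x)` of the fourth Chebyshev polynomial of the first kind. -/
def chebT4 (x : ℝ) : ℝ := (Polynomial.Chebyshev.T ℝ 4).eval x

/-- The principal right inverse of `T_4` on `[-1, 1]`; see `chebT4_invChebT4`. -/
def invChebT4 (x : ℝ) : ℝ := Real.cos (Real.arccos x / 4)

theorem chebT4_invChebT4 {x : ℝ} (hx : x ∈ Set.Icc (-1 : ℝ) 1) : chebT4 (invChebT4 x) = x := by
  have h := Polynomial.Chebyshev.T_real_cos (Real.arccos x / 4) 4
  rw [chebT4, invChebT4, h]
  have : ((4 : ℤ) : ℝ) * (Real.arccos x / 4) = Real.arccos x := by push_cast; ring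
  rw [this, Real.cos_arccos hx.1 hx.2]

/-- The rate `δ⁻¹ log(ε⁻² δ^{-1/4})`. -/
def rate (δ ε : ℝ) : ℝ := δ⁻¹ * Real.log ((ε ^ 2)⁻¹ * δ ^ (-(1 / 4) : ℝ))

end

end QSPGadget

/-! The outer gadget rests on cos(2a-2b) cos(2a+2b) = (cos 4a + cos 4b)/2. A conjugation by `rotZ
(π/2)` inverts an x-rotation, and one by `rotZ (π/4)` makes it real. A palindromic word can
therefore evaluate to X(a+b) Y X(a+b), where Y is a real rotation by 2a-2b, and the corner entry of
this product is the left-hand side (`meanT4_rotX`). Fed with the exact rotations `rotX (arccos x /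
4)`, the word returns the mean of the inputs.

Twisted embeddable operators are the fixed points in SU(2) of the antiautomorphism `pauliFlip`
(`isTwistedEmbeddable_iff`). Palindromic words preserve them, so gadgets compose without correction
gates. Since the outer word uses whole operators, the inner gadget has to approximate the full
matrix of the quarter rotation and not only its corner entry.

For the inner gadget put t = cos² θ and let p be the Taylor polynomial of cos(arcsin(x)/8) in t =
x². Completing p by its θ-derivative gives `phaseApprox`, close to e^{i(θ/8 - π/16)}. The
differential equation of the cosine holds for p up to a single monomial (`cosPoly_ode`). This
controls the error, and with the signs of the Taylor coefficients it shows that 1 - |`phaseApprox`|²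
has nonnegative coefficients in t (`coeff_one_sub_cosModulus_nonneg`). A Fejér–Riesz factorization
(`exists_norm_sq_of_pos`) then completes the approximation to an exact unit row without rescaling,
and peeling off one query at a time realizes that row as a word (`exists_word_of_unit_row`).

A unit row whose first entry is nearly a phase is nearly diagonal, so the word approximates a
z-rotation. A basis change and a shift give `rotX (θ/8)`, and multiplication by the mirror word
gives a flip-invariant approximation of `rotX (θ/4)`. The error decays like a polynomial in m times
(1-δ)^m, so m of order δ⁻¹ log(ε⁻² δ^{-1/4}) suffices (`exists_degree`). -/

namespace QSPGadget

open scoped Matrix.Norms.L2Operator ComplexConjugate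
open Polynomial

/-! ### The group `SU(2)` -/

/-- The special unitary group of one qubit. -/
abbrev SU2 : Submonoid QubitOp := Matrix.specialUnitaryGroup (Fin 2) ℂ

/-- With determinant one the adjoint is the adjugate, so the first row determines the second. -/
theorem mem_SU2_iff {U : QubitOp} :
    U ∈ SU2 ↔ U 1 1 = conj (U 0 0) ∧ U 1 0 = -conj (U 0 1) ∧
      U 0 0 * conj (U 0 0) + U 0 1 * conj (U 0 1) = 1 := by
  rw [Matrix.mem_specialUnitaryGroup_iff, Matrix.mem_unitaryGroup_iff]
  constructor
  · rintro ⟨h, hd⟩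
    rw [Matrix.det_fin_two] at hd
    have h00 := congrFun (congrFun h 0) 0
    have h10 := congrFun (congrFun h 1) 0
    simp only [Matrix.mul_apply, Fin.sum_univ_two, Matrix.star_apply, RCLike.star_def,
      Matrix.one_apply_eq, ne_eq, one_ne_zero, not_false_eq_true, Matrix.one_apply_ne] at h00 h10
    refine ⟨?_, ?_, h00⟩
    · linear_combination (-U 1 1) * h00 + conj (U 0 0) * hd + U 0 1 * h10
    · linear_combination (-U 1 0) * h00 - conj (U 0 1) * hd + U 0 0 * h10
  · rintro ⟨h1, h2, h3⟩
    constructor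
    · ext i j
      fin_cases i <;> fin_cases j <;>
        simp [Matrix.mul_apply, Fin.sum_univ_two, Matrix.star_apply, h1, h2]
      · exact h3
      · ring
      · ring
      · linear_combination h3
    · rw [Matrix.det_fin_two, h1, h2]
      linear_combination h3

theorem SU2.star_mem {U : QubitOp} (hU : U ∈ SU2) : star U ∈ SU2 :=
  (star (⟨U, hU⟩ : Matrix.specialUnitaryGroup (Fin 2) ℂ)).2

theorem SU2.star_mul {U : QubitOp} (hU : U ∈ SU2) : star U * U = 1 :=
  Matrix.mem_unitaryGroup_iff'.1 hU.1

theorem SU2.norm_mul {U : QubitOp} (hU : U ∈ SU2) (A : QubitOp) : ‖U * A‖ = ‖A‖ :=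
  CStarRing.norm_mem_unitary_mul A hU.1

theorem SU2.mul_norm {U : QubitOp} (hU : U ∈ SU2) (A : QubitOp) : ‖A * U‖ = ‖A‖ :=
  CStarRing.norm_mul_mem_unitary A hU.1

/-- The operator norm distance of two elements of `SU(2)` is the Euclidean distance of their first
rows. -/
theorem SU2.norm_sub_sq {U V : QubitOp} (hU : U ∈ SU2) (hV : V ∈ SU2) :
    ‖U - V‖ ^ 2 = ‖U 0 0 - V 0 0‖ ^ 2 + ‖U 0 1 - V 0 1‖ ^ 2 := by
  obtain ⟨u1, u2, -⟩ := mem_SU2_iff.1 hU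
  obtain ⟨v1, v2, -⟩ := mem_SU2_iff.1 hV
  -- Elements of SU(2) are unit quaternions, so a difference of two is a real multiple of a unitary.
  have key : star (U - V) * (U - V)
      = ((‖U 0 0 - V 0 0‖ ^ 2 + ‖U 0 1 - V 0 1‖ ^ 2 : ℝ) : ℂ) • (1 : QubitOp) := by
    push_cast
    rw [← Complex.mul_conj', ← Complex.mul_conj']
    ext i j
    fin_cases i <;> fin_cases j <;>
      simp [Matrix.mul_apply, Fin.sum_univ_two, Matrix.star_apply, u1, u2, v1, v2] <;> ring
  rw [sq, ← CStarRing.norm_star_mul_self, key, norm_smul, norm_one, mul_one, Complex.norm_real,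
    Real.norm_of_nonneg (by positivity)]

theorem SU2.norm_entry_sub_le {U V : QubitOp} (hU : U ∈ SU2) (hV : V ∈ SU2) :
    ‖U 0 0 - V 0 0‖ ≤ ‖U - V‖ := by
  apply le_of_sq_le_sq _ (norm_nonneg _)
  rw [SU2.norm_sub_sq hU hV]
  have := sq_nonneg ‖U 0 1 - V 0 1‖
  linarith

theorem SU2.norm_mul_sub_mul_le {U U' V V' : QubitOp} (hU : U ∈ SU2) (hV' : V' ∈ SU2) :
    ‖U * V - U' * V'‖ ≤ ‖U - U'‖ + ‖V - V'‖ := by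
  have : U * V - U' * V' = (U - U') * V' + U * (V - V') := by noncomm_ring
  rw [this]
  exact (norm_add_le _ _).trans (by rw [SU2.mul_norm hV', SU2.norm_mul hU])

/-! ### Rotations -/

theorem rotX_mem_SU2 (θ : ℝ) : rotX θ ∈ SU2 := by
  rw [mem_SU2_iff]
  have h := Complex.cos_sq_add_sin_sq (θ : ℂ)
  refine ⟨?_, ?_, ?_⟩ <;> simp [rotX, ← Complex.cos_conj, ← Complex.sin_conj]
  linear_combination h - (Complex.sin θ) ^ 2 * Complex.I_sq

theorem rotZ_mem_SU2 (φ : ℝ) : rotZ φ ∈ SU2 := by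
  rw [mem_SU2_iff]
  refine ⟨?_, ?_, ?_⟩ <;> simp [rotZ, ← Complex.exp_conj, ← Complex.exp_add]

theorem rotX_mul_rotX (α β : ℝ) : rotX α * rotX β = rotX (α + β) := by
  ext i j
  fin_cases i <;> fin_cases j <;>
    simp [rotX, Matrix.mul_apply, Fin.sum_univ_two, Complex.cos_add, Complex.sin_add]
  · linear_combination (Complex.sin α * Complex.sin β) * Complex.I_sq
  · ring
  · ring
  · linear_combination (Complex.sin α * Complex.sin β) * Complex.I_sq

/-! ### The reflection `M ↦ σ_x Mᵀ σ_x` -/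

/-- The antiautomorphism `M ↦ σ_x Mᵀ σ_x`; it fixes `1`, `σ_x`, `σ_y` and negates `σ_z`. -/
def pauliFlip (M : QubitOp) : QubitOp := !![M 1 1, M 0 1; M 1 0, M 0 0]

theorem pauliFlip_mul (M N : QubitOp) : pauliFlip (M * N) = pauliFlip N * pauliFlip M := by
  ext i j
  fin_cases i <;> fin_cases j <;>
    simp [pauliFlip, Matrix.mul_apply, Fin.sum_univ_two] <;> ring

theorem pauliFlip_one : pauliFlip 1 = 1 := by
  ext i j
  fin_cases i <;> fin_cases j <;> simp [pauliFlip]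

theorem pauliFlip_pauliFlip (M : QubitOp) : pauliFlip (pauliFlip M) = M := by
  ext i j
  fin_cases i <;> fin_cases j <;> simp [pauliFlip]

theorem pauliFlip_rotX (θ : ℝ) : pauliFlip (rotX θ) = rotX θ := by
  simp [pauliFlip, rotX]

theorem pauliFlip_rotZ (φ : ℝ) : pauliFlip (rotZ φ) = rotZ (-φ) := by
  simp [pauliFlip, rotZ]

theorem pauliFlip_mem_SU2 {U : QubitOp} (hU : U ∈ SU2) : pauliFlip U ∈ SU2 := by
  rw [mem_SU2_iff] at hU ⊢
  obtain ⟨h1, h2, h3⟩ := hU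
  simp only [pauliFlip, Matrix.of_apply, Matrix.cons_val', Matrix.cons_val_zero,
    Matrix.cons_val_one, Matrix.cons_val_fin_one, h1, h2]
  refine ⟨by simp, trivial, ?_⟩
  rw [Complex.conj_conj]
  linear_combination h3

theorem norm_pauliFlip_sub {U V : QubitOp} (hU : U ∈ SU2) (hV : V ∈ SU2) :
    ‖pauliFlip U - pauliFlip V‖ = ‖U - V‖ := by
  have h := SU2.norm_sub_sq (pauliFlip_mem_SU2 hU) (pauliFlip_mem_SU2 hV)
  have h' := SU2.norm_sub_sq hU hV
  have e1 : ∀ M : QubitOp, pauliFlip M 0 0 = M 1 1 := fun _ => rfl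
  have e2 : ∀ M : QubitOp, pauliFlip M 0 1 = M 0 1 := fun _ => rfl
  rw [e1, e1, e2, e2, (mem_SU2_iff.1 hU).1, (mem_SU2_iff.1 hV).1, ← map_sub, RCLike.norm_conj,
    ← h'] at h
  exact (pow_left_inj₀ (norm_nonneg _) (norm_nonneg _) two_ne_zero).1 h

/-- Twisted embeddable operators are the elements of `SU(2)` without `σ_z` component. -/
theorem isTwistedEmbeddable_iff {U : QubitOp} :
    IsTwistedEmbeddable U ↔ U ∈ SU2 ∧ pauliFlip U = U := by
  constructor
  · rintro ⟨θ, -, φ, -, rfl⟩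
    refine ⟨SU2.mul_mem (SU2.mul_mem (rotZ_mem_SU2 _) (rotX_mem_SU2 _)) (rotZ_mem_SU2 _), ?_⟩
    rw [pauliFlip_mul, pauliFlip_mul, pauliFlip_rotX, pauliFlip_rotZ, pauliFlip_rotZ, mul_assoc]
    congr 2
    · ring
    · congr 1; ring
  · rintro ⟨hU, hf⟩
    obtain ⟨h1, h2, h3⟩ := mem_SU2_iff.1 hU
    have hd : U 1 1 = U 0 0 := by
      have := congrFun (congrFun hf 0) 0
      simpa [pauliFlip] using this
    obtain ⟨a, ha⟩ := Complex.conj_eq_iff_real.1 (h1.symm.trans hd)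
    set b := U 0 1 with hb
    have hsq : a ^ 2 + ‖b‖ ^ 2 = 1 := by
      rw [ha, Complex.mul_conj', Complex.mul_conj', Complex.norm_real, Real.norm_eq_abs] at h3
      have : |a| ^ 2 + ‖b‖ ^ 2 = 1 := by exact_mod_cast h3
      rwa [sq_abs] at this
    have hac : Real.cos (Real.arccos a) = a :=
      Real.cos_arccos (by nlinarith [sq_nonneg ‖b‖]) (by nlinarith [sq_nonneg ‖b‖])
    have has : Real.sin (Real.arccos a) = ‖b‖ := by
      rw [Real.sin_arccos, show 1 - a ^ 2 = ‖b‖ ^ 2 by linarith, Real.sqrt_sq (norm_nonneg _)]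
    -- The twisted form has upper right entry i sin θ e^{iφ}, so φ is the argument of -i b.
    have harg := Complex.norm_mul_exp_arg_mul_I (-Complex.I * b)
    rw [norm_mul, norm_neg, Complex.norm_I, one_mul] at harg
    set φ := Complex.arg (-Complex.I * b) with hφ
    refine ⟨Real.arccos a, ⟨Real.arccos_nonneg _, Real.arccos_le_pi _⟩, φ,
      ⟨(Complex.neg_pi_lt_arg _).le, Complex.arg_le_pi _⟩, ?_⟩
    have hbe : b = Complex.I * ‖b‖ * Complex.exp (Complex.I * φ) := by
      rw [mul_comm Complex.I (φ : ℂ)]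
      linear_combination (-Complex.I) * harg + b * Complex.I_sq
    have hexp : Complex.exp (Complex.I * φ)
        = Complex.exp (Complex.I * (φ / 2 : ℝ)) * Complex.exp (-(Complex.I * (-φ / 2 : ℝ))) := by
      rw [← Complex.exp_add]
      push_cast
      ring_nf
    have hexp' : Complex.exp (-(Complex.I * φ))
        = Complex.exp (-(Complex.I * (φ / 2 : ℝ))) * Complex.exp (Complex.I * (-φ / 2 : ℝ)) := by
      rw [← Complex.exp_add]
      push_cast
      ring_nf
    have hbe' : conj b = -(Complex.I * ‖b‖ * Complex.exp (-(Complex.I * φ))) := by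
      have := congrArg conj hbe
      rw [this]
      simp [← Complex.exp_conj]
    ext i j
    fin_cases i <;> fin_cases j <;>
      simp only [rotZ, rotX, hac, has, Matrix.mul_apply, Fin.sum_univ_two, Fin.zero_eta,
        Fin.mk_one, Matrix.of_apply, Matrix.cons_val', Matrix.cons_val_zero,
        Matrix.cons_val_one, Matrix.cons_val_fin_one, mul_zero, zero_mul, add_zero, zero_add]
    · rw [ha, mul_right_comm, ← Complex.exp_add]
      push_cast
      ring_nf
      simp
    · rw [← hb]
      refine hbe.trans ?_
      rw [hexp]
      ring
    · rw [h2, hbe', hexp']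
      ring
    · rw [hd, ha, mul_right_comm, ← Complex.exp_add]
      push_cast
      ring_nf
      simp

theorem IsEmbeddable.isTwistedEmbeddable {U : QubitOp} (hU : IsEmbeddable U) :
    IsTwistedEmbeddable U := by
  obtain ⟨θ, -, rfl⟩ := hU
  exact isTwistedEmbeddable_iff.2 ⟨rotX_mem_SU2 θ, pauliFlip_rotX θ⟩

/-! ### Words of gates -/

/-- The operator of a word of gates: the product of its gates, in list order. -/
def wordEval {a : ℕ} (U : Fin a → QubitOp) (g : List (Gate a)) : QubitOp :=
  (g.map (Gate.eval U)).prod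

theorem wordEval_nil {a : ℕ} (U : Fin a → QubitOp) : wordEval U [] = 1 := rfl

theorem wordEval_cons {a : ℕ} (U : Fin a → QubitOp) (x : Gate a) (g : List (Gate a)) :
    wordEval U (x :: g) = x.eval U * wordEval U g := by
  simp [wordEval]

theorem wordEval_append {a : ℕ} (U : Fin a → QubitOp) (g h : List (Gate a)) :
    wordEval U (g ++ h) = wordEval U g * wordEval U h := by
  simp [wordEval]

/-- The fixed gate of an element of `SU(2)`. -/
def specialGate {a : ℕ} (W : SU2) : Gate a := .fixed ⟨W.1, W.2.1⟩

theorem eval_specialGate {a : ℕ} (U : Fin a → QubitOp) (W : SU2) :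
    (specialGate W).eval U = W.1 := rfl

/-- All fixed gates of the word have determinant one. -/
def IsSpecialWord {a : ℕ} (g : List (Gate a)) : Prop :=
  ∀ x ∈ g, ∀ U : Fin a → QubitOp, (∀ j, U j ∈ SU2) → x.eval U ∈ SU2

theorem IsSpecialWord.nil {a : ℕ} : IsSpecialWord ([] : List (Gate a)) := by
  simp [IsSpecialWord]

theorem IsSpecialWord.cons_special {a : ℕ} {g : List (Gate a)} (hg : IsSpecialWord g) (W : SU2) :
    IsSpecialWord (specialGate W :: g) := by
  intro x hx
  rcases List.mem_cons.1 hx with rfl | hx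
  · exact fun _ _ => W.2
  · exact hg x hx

theorem IsSpecialWord.cons_query {a : ℕ} {g : List (Gate a)} (hg : IsSpecialWord g) (j : Fin a) :
    IsSpecialWord (.query j :: g) := by
  intro x hx
  rcases List.mem_cons.1 hx with rfl | hx
  · exact fun U hU => hU j
  · exact hg x hx

theorem IsSpecialWord.append {a : ℕ} {g h : List (Gate a)} (hg : IsSpecialWord g)
    (hh : IsSpecialWord h) : IsSpecialWord (g ++ h) := by
  intro x hx
  rcases List.mem_append.1 hx with hx | hx
  · exact hg x hx
  · exact hh x hx

theorem IsSpecialWord.wordEval_mem {a : ℕ} {g : List (Gate a)} (hg : IsSpecialWord g)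
    {U : Fin a → QubitOp} (hU : ∀ j, U j ∈ SU2) : wordEval U g ∈ SU2 := by
  apply Submonoid.list_prod_mem
  intro M hM
  obtain ⟨x, hx, rfl⟩ := List.mem_map.1 hM
  exact hg x hx U hU

/-- A word of `n` gates amplifies errors in the oracles by at most the factor `n`. -/
theorem IsSpecialWord.norm_wordEval_sub_le {a : ℕ} {g : List (Gate a)} (hg : IsSpecialWord g)
    {U V : Fin a → QubitOp} (hU : ∀ j, U j ∈ SU2) (hV : ∀ j, V j ∈ SU2) {η : ℝ}
    (hη : ∀ j, ‖U j - V j‖ ≤ η) (hη0 : 0 ≤ η) :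
    ‖wordEval U g - wordEval V g‖ ≤ g.length * η := by
  induction g with
  | nil => simp [wordEval_nil]
  | cons x g ih =>
    have hg' : IsSpecialWord g := fun y hy => hg y (List.mem_cons_of_mem _ hy)
    rw [wordEval_cons, wordEval_cons]
    refine (SU2.norm_mul_sub_mul_le (hg x List.mem_cons_self U hU)
      (hg'.wordEval_mem hV)).trans ?_
    have hx : ‖x.eval U - x.eval V‖ ≤ η := by
      cases x with
      | query j => exact hη j
      | fixed W => simpa [Gate.eval] using hη0
    have := ih hg'
    rw [List.length_cons]
    push_cast
    linarith

/-- Every special word has a mirror image, evaluating to the reflected operator. -/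
theorem IsSpecialWord.exists_mirror {a : ℕ} {g : List (Gate a)} (hg : IsSpecialWord g) :
    ∃ g' : List (Gate a), g'.length = g.length ∧ IsSpecialWord g' ∧
      ∀ U : Fin a → QubitOp, (∀ j, pauliFlip (U j) = U j) →
        wordEval U g' = pauliFlip (wordEval U g) := by
  induction g with
  | nil => exact ⟨[], rfl, IsSpecialWord.nil, fun U _ => by simp [wordEval_nil, pauliFlip_one]⟩
  | cons x g ih =>
    obtain ⟨g', hl, hs, he⟩ := ih fun y hy => hg y (List.mem_cons_of_mem _ hy)
    cases x with
    | query j =>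
      refine ⟨g' ++ [.query j], by simp [hl], hs.append (IsSpecialWord.nil.cons_query j),
        fun U hU => ?_⟩
      rw [wordEval_append, he U hU, wordEval_cons, wordEval_cons, wordEval_nil, mul_one,
        pauliFlip_mul]
      congr 1
      exact (hU j).symm
    | fixed W =>
      have hW : (W : QubitOp) ∈ SU2 :=
        hg _ List.mem_cons_self (fun _ => 1) (fun _ => SU2.one_mem)
      refine ⟨g' ++ [specialGate ⟨_, pauliFlip_mem_SU2 hW⟩], by simp [hl],
        hs.append (IsSpecialWord.nil.cons_special _), fun U hU => ?_⟩
      rw [wordEval_append, he U hU, wordEval_cons, wordEval_cons, wordEval_nil, mul_one,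
        pauliFlip_mul]
      rfl

/-! ### Cost, depth and composition of circuits -/

theorem Circuit.cost_le_depth {a b : ℕ} (C : Circuit a b) (k : Fin b) : C.cost k ≤ C.depth k := by
  unfold Circuit.cost Circuit.costMatrix Circuit.depth
  induction C k with
  | nil => simp
  | cons x g ih =>
    simp only [List.countP_cons, Finset.sum_add_distrib, List.length_cons]
    refine add_le_add ih ?_
    cases x with
    | query i => simp [Gate.isQuery]
    | fixed W => simp [Gate.isQuery]

theorem Circuit.depth_comp_le {a c d : ℕ} (S : Circuit c d) (R : Circuit a c) {n : ℕ}
    (hn : 1 ≤ n) (hR : ∀ j, R.depth j ≤ n) (k : Fin d) :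
    (S.comp R).depth k ≤ S.depth k * n := by
  unfold Circuit.depth Circuit.comp
  induction S k with
  | nil => simp
  | cons x g ih =>
    rw [List.flatMap_cons, List.length_append, List.length_cons, add_mul, one_mul, add_comm]
    refine add_le_add ih ?_
    cases x with
    | query j => exact hR j
    | fixed W => exact hn

theorem Circuit.toSuperOp_comp {a c d : ℕ} (S : Circuit c d) (R : Circuit a c)
    (U : Fin a → QubitOp) : (S.comp R).toSuperOp U = S.toSuperOp (R.toSuperOp U) := by
  funext k
  simp only [Circuit.comp, Circuit.toSuperOp]
  induction S k with
  | nil => rfl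
  | cons x g ih =>
    rw [List.flatMap_cons, List.map_append, List.prod_append, ih, List.map_cons, List.prod_cons]
    cases x with
    | query j => rfl
    | fixed W => simp [Gate.eval]

theorem Circuit.toSuperOp_copies {a : ℕ} (R : Circuit 1 1) (U : Fin a → QubitOp) (j : Fin a) :
    (R.copies a).toSuperOp U j = R.toSuperOp (fun _ => U j) 0 := by
  unfold Circuit.copies Circuit.toSuperOp
  rw [List.map_map]
  congr 1
  apply List.map_congr_left
  intro x _
  cases x <;> rfl

theorem Circuit.depth_copies {a : ℕ} (R : Circuit 1 1) (j : Fin a) :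
    (R.copies a).depth j = R.depth 0 := by
  simp [Circuit.copies, Circuit.depth]

/-! ### The gadget `(T₄(x₀) + T₄(x₁)) / 2` -/

/-- The fixed gate `e^{iφσ_z}`. -/
noncomputable def zGate {a : ℕ} (φ : ℝ) : Gate a := specialGate ⟨rotZ φ, rotZ_mem_SU2 φ⟩

/-- A palindromic word for `(T₄(x₀) + T₄(x₁)) / 2`. -/
noncomputable def meanT4Word : List (Gate 2) :=
  [.query 0, .query 1, zGate (Real.pi / 4), .query 0, zGate (Real.pi / 2), .query 1, .query 1,
    zGate (-(Real.pi / 2)), .query 0, zGate (-(Real.pi / 4)), .query 1, .query 0]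

theorem isSpecialWord_meanT4Word : IsSpecialWord meanT4Word := by
  unfold meanT4Word zGate
  repeat' first
    | exact IsSpecialWord.nil
    | apply IsSpecialWord.cons_query
    | apply IsSpecialWord.cons_special

/-- The circuit of `meanT4Word`. -/
noncomputable def meanT4 : Circuit 2 1 := fun _ => meanT4Word

theorem wordEval_meanT4Word (U : Fin 2 → QubitOp) :
    wordEval U meanT4Word = U 0 * (U 1 * (rotZ (Real.pi / 4) * (U 0 * (rotZ (Real.pi / 2) *
      (U 1 * (U 1 * (rotZ (-(Real.pi / 2)) * (U 0 * (rotZ (-(Real.pi / 4)) *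
      (U 1 * U 0)))))))))) := by
  simp [meanT4Word, wordEval, Gate.eval, zGate, specialGate]

/-- The circuit preserves twisted embeddability, not only embeddability. -/
theorem isTwistedEmbeddable_meanT4 {U : Fin 2 → QubitOp} (hU : ∀ j, IsTwistedEmbeddable (U j))
    (k : Fin 1) : IsTwistedEmbeddable (meanT4.toSuperOp U k) := by
  change IsTwistedEmbeddable (wordEval U meanT4Word)
  rw [isTwistedEmbeddable_iff]
  refine ⟨isSpecialWord_meanT4Word.wordEval_mem fun j => (isTwistedEmbeddable_iff.1 (hU j)).1, ?_⟩
  have h0 := (isTwistedEmbeddable_iff.1 (hU 0)).2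
  have h1 := (isTwistedEmbeddable_iff.1 (hU 1)).2
  -- The flip reverses the word and negates the z-angles. The word is a palindrome with opposite
  -- angles at mirrored places, so it is unchanged.
  simp only [wordEval_meanT4Word, pauliFlip_mul, pauliFlip_rotZ, h0, h1, neg_neg, mul_assoc]

/-- The conjugating operator is iσ_z, which anticommutes with σ_x. Inverse oracles are thus
available from forward queries. -/
theorem rotZ_conj_rotX_pi_div_two (θ : ℝ) (M : QubitOp) :
    rotZ (Real.pi / 2) * (rotX θ * (rotZ (-(Real.pi / 2)) * M)) = rotX (-θ) * M := by
  have h : rotZ (Real.pi / 2) * rotX θ * rotZ (-(Real.pi / 2)) = rotX (-θ) := by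
    have e1 : Complex.exp (Complex.I * ((Real.pi / 2 : ℝ) : ℂ)) = Complex.I := by
      rw [mul_comm]; push_cast; exact Complex.exp_pi_div_two_mul_I
    have e2 : Complex.exp (-(Complex.I * ((Real.pi / 2 : ℝ) : ℂ))) = -Complex.I := by
      rw [Complex.exp_neg, e1, Complex.inv_I]
    simp only [rotZ, Complex.ofReal_neg, mul_neg, neg_neg, e1, e2]
    ext i j
    fin_cases i <;> fin_cases j <;>
      simp [rotX, Matrix.mul_apply, Fin.sum_univ_two]
    · linear_combination (-Complex.cos θ) * Complex.I_sq
    · linear_combination (Complex.I * Complex.sin θ) * Complex.I_sq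
    · linear_combination (Complex.I * Complex.sin θ) * Complex.I_sq
    · linear_combination (-Complex.cos θ) * Complex.I_sq
  rw [← h]
  simp only [mul_assoc]

/-- A quarter turn about the z-axis of the Bloch sphere carries the x-axis to the y-axis up to sign,
and y-rotations are real. -/
theorem rotZ_conj_rotX_pi_div_four (θ : ℝ) :
    rotZ (Real.pi / 4) * rotX θ * rotZ (-(Real.pi / 4))
      = !![(Real.cos θ : ℂ), -(Real.sin θ : ℂ); (Real.sin θ : ℂ), (Real.cos θ : ℂ)] := by
  have e1 : Complex.exp (Complex.I * ((Real.pi / 4 : ℝ) : ℂ)) ^ 2 = Complex.I := by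
    rw [← Complex.exp_nat_mul]
    refine Eq.trans (congrArg Complex.exp ?_) Complex.exp_pi_div_two_mul_I
    push_cast
    ring
  set z := Complex.exp (Complex.I * ((Real.pi / 4 : ℝ) : ℂ)) with hz
  have hz0 : z ≠ 0 := Complex.exp_ne_zero _
  have e2 : (z⁻¹) ^ 2 = -Complex.I := by rw [inv_pow, e1, Complex.inv_I]
  simp only [rotZ, Complex.ofReal_neg, mul_neg, neg_neg, Complex.exp_neg, ← hz]
  ext i j
  fin_cases i <;> fin_cases j <;>
    simp [rotX, Matrix.mul_apply, Fin.sum_univ_two]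
  · field_simp
  · linear_combination (Complex.I * Complex.sin θ) * e1 + Complex.sin θ * Complex.I_sq
  · linear_combination (Complex.I * Complex.sin θ) * e2 - Complex.sin θ * Complex.I_sq
  · field_simp

/-- In X(β) Y(α) X(β) the off-diagonal entries of Y(α) are antisymmetric and cancel in the corner.
What remains is cos α cos 2β with α = 2θ₀ - 2θ₁ and β = θ₀ + θ₁. -/
theorem meanT4_rotX (θ : Fin 2 → ℝ) (k : Fin 1) :
    meanT4.toSuperOp (fun j => rotX (θ j)) k 0 0
      = (((Real.cos (4 * θ 0) + Real.cos (4 * θ 1)) / 2 : ℝ) : ℂ) := by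
  change wordEval (fun j => rotX (θ j)) meanT4Word 0 0 = _
  have h : wordEval (fun j => rotX (θ j)) meanT4Word
      = rotX (θ 0 + θ 1) * (rotZ (Real.pi / 4) * rotX (2 * θ 0 - 2 * θ 1) *
        rotZ (-(Real.pi / 4))) * rotX (θ 0 + θ 1) := by
    have e : rotX (2 * θ 0 - 2 * θ 1) = rotX (θ 0) * (rotX (-(θ 1 + θ 1)) * rotX (θ 0)) := by
      rw [rotX_mul_rotX, rotX_mul_rotX]
      congr 1
      ring
    have e1 : rotX (θ 1) * rotX (θ 0) = rotX (θ 0 + θ 1) := by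
      rw [rotX_mul_rotX, add_comm]
    rw [wordEval_meanT4Word, e1, ← mul_assoc (rotX (θ 1)) (rotX (θ 1)), rotX_mul_rotX (θ 1),
      rotZ_conj_rotX_pi_div_two, e, ← rotX_mul_rotX (θ 0) (θ 1)]
    simp only [mul_assoc]
  have hr : (Real.cos (4 * θ 0) + Real.cos (4 * θ 1)) / 2
      = Real.cos (2 * θ 0 - 2 * θ 1) * (Real.cos (θ 0 + θ 1) ^ 2 - Real.sin (θ 0 + θ 1) ^ 2) := by
    rw [← Real.cos_two_mul', Real.cos_add_cos]
    ring_nf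
  rw [h, rotZ_conj_rotX_pi_div_four, hr]
  generalize 2 * θ 0 - 2 * θ 1 = α
  generalize θ 0 + θ 1 = β
  simp only [rotX, Matrix.mul_apply, Fin.sum_univ_two, Matrix.of_apply, Matrix.cons_val',
    Matrix.cons_val_zero, Matrix.cons_val_one, Matrix.cons_val_fin_one]
  push_cast
  linear_combination (Complex.cos α * Complex.sin β ^ 2) * Complex.I_sq

/-! ### Synthesis of `SU(2)`-valued trigonometric polynomials -/

/-- The element of `SU(2)` with first row `(p, q)`. -/
def ofRow (p q : ℂ) (h : ‖p‖ ^ 2 + ‖q‖ ^ 2 = 1) : SU2 :=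
  ⟨!![p, q; -conj q, conj p], by
    rw [mem_SU2_iff]
    refine ⟨rfl, rfl, ?_⟩
    change p * conj p + q * conj q = 1
    rw [Complex.mul_conj', Complex.mul_conj']
    exact_mod_cast h⟩

theorem exists_unit_multiple {c d : ℂ} (h : c ≠ 0 ∨ d ≠ 0) :
    ∃ p q r : ℂ, ‖p‖ ^ 2 + ‖q‖ ^ 2 = 1 ∧ r ≠ 0 ∧ c = r * p ∧ d = r * q := by
  have hpos : 0 < ‖c‖ ^ 2 + ‖d‖ ^ 2 := by
    rcases h with h | h
    · have := norm_pos_iff.2 h; positivity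
    · have := norm_pos_iff.2 h; positivity
  set s := Real.sqrt (‖c‖ ^ 2 + ‖d‖ ^ 2) with hs
  have hs0 : 0 < s := Real.sqrt_pos.2 hpos
  have hss : s ^ 2 = ‖c‖ ^ 2 + ‖d‖ ^ 2 := Real.sq_sqrt hpos.le
  have hsc : (s : ℂ) ≠ 0 := by exact_mod_cast hs0.ne'
  refine ⟨c / s, d / s, s, ?_, hsc, by field_simp, by field_simp⟩
  rw [norm_div, norm_div, Complex.norm_real, Real.norm_of_nonneg hs0.le, div_pow, div_pow,
    ← add_div, hss, div_self hpos.ne']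

/-- If two vectors of `ℂ²` are orthogonal, some unit vector is orthogonal to the first and parallel
to the second. -/
theorem exists_unit_orthogonal_parallel {a b c d : ℂ} (h : a * conj c + b * conj d = 0) :
    ∃ p q : ℂ, ‖p‖ ^ 2 + ‖q‖ ^ 2 = 1 ∧ a * conj p + b * conj q = 0 ∧ p * d = q * c := by
  by_cases hcd : c ≠ 0 ∨ d ≠ 0
  · obtain ⟨p, q, r, hu, hr, rfl, rfl⟩ := exists_unit_multiple hcd
    refine ⟨p, q, hu, ?_, by ring⟩
    rw [map_mul, map_mul] at h
    have hr' : conj r ≠ 0 := by simpa using hr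
    apply mul_left_cancel₀ hr'
    linear_combination h
  · push Not at hcd
    obtain ⟨rfl, rfl⟩ := hcd
    by_cases hab : a ≠ 0 ∨ b ≠ 0
    · obtain ⟨p, q, r, hu, -, rfl, rfl⟩ := exists_unit_multiple hab
      refine ⟨-conj q, conj p, ?_, ?_, by simp⟩
      · rw [norm_neg, RCLike.norm_conj, RCLike.norm_conj]
        linarith
      · simp only [map_neg, Complex.conj_conj]
        ring
    · push Not at hab
      obtain ⟨rfl, rfl⟩ := hab
      exact ⟨1, 0, by simp, by simp, by simp⟩

/-- On the unit circle conj w = w⁻¹, so conjugation of values becomes reversal of conjugated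
coefficients. -/
theorem eval_reflect_conj {n : ℕ} {P : ℂ[X]} (hP : P.natDegree ≤ n) {w : ℂ} (hw : ‖w‖ = 1) :
    ((P.map (starRingEnd ℂ)).reflect n).eval w = w ^ n * conj (P.eval w) := by
  have hw1 : w * conj w = 1 := by rw [Complex.mul_conj', hw]; simp
  have hw2 : conj w * w = 1 := by rw [mul_comm, hw1]
  let _ : Invertible (conj w) := ⟨w, hw1, hw2⟩
  have h := eval₂_reflect_mul_pow (RingHom.id ℂ) (conj w) n (P.map (starRingEnd ℂ))
    (natDegree_map_le.trans hP)
  have hinv : ⅟ (conj w) = w := rfl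
  rw [hinv, eval₂_id, eval₂_id, eval_map, eval₂_hom] at h
  rw [← h, mul_comm, mul_assoc, ← mul_pow, hw2, one_pow, mul_one]

theorem infinite_unit_circle : {w : ℂ | ‖w‖ = 1}.Infinite := by
  have h : (Set.Ioc (-Real.pi) Real.pi).InjOn fun t : ℝ => Complex.exp (t * Complex.I) := by
    intro s hs t ht hst
    have := congrArg Complex.arg hst
    simpa only [Complex.arg_exp_mul_I, (toIocMod_eq_self _).2
      (show s ∈ Set.Ioc (-Real.pi) (-Real.pi + 2 * Real.pi) from ⟨hs.1, by linarith [hs.2]⟩),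
      (toIocMod_eq_self _).2
      (show t ∈ Set.Ioc (-Real.pi) (-Real.pi + 2 * Real.pi) from ⟨ht.1, by linarith [ht.2]⟩)]
      using this
  refine ((Set.Ioc_infinite (by linarith [Real.pi_pos])).image h).mono ?_
  rintro _ ⟨t, -, rfl⟩
  exact Complex.norm_exp_ofReal_mul_I t

/-- Multiplied by w^{n+1}, the unit length condition becomes a polynomial identity with right side
X^{n+1}. The claim is its constant coefficient, the extreme Fourier coefficient of |P|² + |Q|². -/
theorem coeff_orthogonal {n : ℕ} {P Q : ℂ[X]} (hP : P.natDegree ≤ n + 1)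
    (hQ : Q.natDegree ≤ n + 1) (h : ∀ w : ℂ, ‖w‖ = 1 → ‖P.eval w‖ ^ 2 + ‖Q.eval w‖ ^ 2 = 1) :
    P.coeff 0 * conj (P.coeff (n + 1)) + Q.coeff 0 * conj (Q.coeff (n + 1)) = 0 := by
  have hid : P * (P.map (starRingEnd ℂ)).reflect (n + 1)
      + Q * (Q.map (starRingEnd ℂ)).reflect (n + 1) = X ^ (n + 1) := by
    apply eq_of_infinite_eval_eq
    refine infinite_unit_circle.mono fun w hw => ?_
    have hw : ‖w‖ = 1 := hw
    have h1 : ((‖P.eval w‖ : ℂ)) ^ 2 + (‖Q.eval w‖ : ℂ) ^ 2 = 1 := by exact_mod_cast h w hw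
    rw [Set.mem_ofPred_eq, eval_add, eval_mul, eval_mul, eval_reflect_conj hP hw,
      eval_reflect_conj hQ hw, eval_pow, eval_X]
    rw [← Complex.mul_conj', ← Complex.mul_conj'] at h1
    linear_combination w ^ (n + 1) * h1
  have hc := congrArg (fun R => R.coeff 0) hid
  simp only [coeff_add, mul_coeff_zero, coeff_X_pow, coeff_reflect, revAt_zero, coeff_map] at hc
  simpa using hc

/-- The change of basis from `σ_x` to `σ_z`. -/
noncomputable def basisChange : SU2 :=
  ofRow (√2 / 2 : ℝ) (√2 / 2 : ℝ) (by
    rw [Complex.norm_real, Real.norm_of_nonneg (by positivity), div_pow,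
      Real.sq_sqrt (by norm_num)]
    norm_num)

theorem basisChange_conj_rotX (θ : ℝ) :
    basisChange.1 * rotX θ * star basisChange.1 = rotZ θ := by
  have hs : ((√2 / 2 : ℝ) : ℂ) ^ 2 = 1 / 2 := by
    rw [← Complex.ofReal_pow, div_pow, Real.sq_sqrt (by norm_num)]; norm_num
  have e1 : Complex.exp (Complex.I * (θ : ℂ))
      = Complex.cos θ + Complex.sin θ * Complex.I := by
    rw [mul_comm, Complex.exp_mul_I]
  have e2 : Complex.exp (-(Complex.I * (θ : ℂ)))
      = Complex.cos θ - Complex.sin θ * Complex.I := by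
    rw [show -(Complex.I * (θ : ℂ)) = (-(θ : ℂ)) * Complex.I by ring, Complex.exp_mul_I,
      Complex.cos_neg, Complex.sin_neg]
    ring
  simp only [basisChange, ofRow]
  generalize √2 / 2 = r at hs
  ext i j
  fin_cases i <;> fin_cases j <;>
    simp [rotX, rotZ, Matrix.mul_apply, Fin.sum_univ_two, Matrix.star_apply,
      e1, e2]
  · linear_combination ((Complex.cos θ + Complex.sin θ * Complex.I) * 2) * hs
  · ring
  · ring
  · linear_combination ((Complex.cos θ - Complex.sin θ * Complex.I) * 2) * hs

/-- A pair of polynomials of degree at most `n`, of unit length on the unit circle, is up to a phase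
the first row of a word with `n` queries. -/
theorem exists_word_of_unit_row (n : ℕ) : ∀ P Q : ℂ[X], P.natDegree ≤ n → Q.natDegree ≤ n →
    (∀ w : ℂ, ‖w‖ = 1 → ‖P.eval w‖ ^ 2 + ‖Q.eval w‖ ^ 2 = 1) →
    ∃ g : List (Gate 1), IsSpecialWord g ∧ g.length = 4 * n + 1 ∧ ∀ θ : ℝ,
      wordEval (fun _ => rotX θ) g 0 0
        = Complex.exp (-(Complex.I * θ)) ^ n * P.eval (Complex.exp (Complex.I * θ) ^ 2) ∧
      wordEval (fun _ => rotX θ) g 0 1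
        = Complex.exp (-(Complex.I * θ)) ^ n * Q.eval (Complex.exp (Complex.I * θ) ^ 2) := by
  induction n with
  | zero =>
    intro P Q hP hQ h
    obtain ⟨p, rfl⟩ := natDegree_eq_zero.1 (Nat.le_zero.1 hP)
    obtain ⟨q, rfl⟩ := natDegree_eq_zero.1 (Nat.le_zero.1 hQ)
    have hu : ‖p‖ ^ 2 + ‖q‖ ^ 2 = 1 := by simpa using h 1 (by simp)
    refine ⟨[specialGate (ofRow p q hu)], IsSpecialWord.nil.cons_special _, rfl, fun θ => ?_⟩
    simp [wordEval, eval_specialGate, ofRow]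
  | succ n ih =>
    intro P Q hP hQ h
    obtain ⟨p, q, hu, ho, hp⟩ := exists_unit_orthogonal_parallel (coeff_orthogonal hP hQ h)
    have hu' : p * conj p + q * conj q = 1 := by
      rw [Complex.mul_conj', Complex.mul_conj']
      exact_mod_cast hu
    -- (A, B) is the row (P, Q) times the inverse of `ofRow p q`. Orthogonality kills the constant
    -- term of A and parallelism kills the top term of B. Removing one factor `rotZ θ` then leaves
    -- the row (A/X, B) of degree at most n.
    set A : ℂ[X] := C (conj p) * P + C (conj q) * Q with hA
    set B : ℂ[X] := C p * Q - C q * P with hB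
    have hA0 : A.coeff 0 = 0 := by
      simp only [hA, coeff_add, coeff_C_mul]
      linear_combination ho
    have hAX : A = X * A.divX := by
      conv_lhs => rw [← A.X_mul_divX_add, hA0]
      simp
    have hAd : A.natDegree ≤ n + 1 := by
      refine natDegree_add_le_of_degree_le ?_ ?_
      · exact (natDegree_C_mul_le _ _).trans hP
      · exact (natDegree_C_mul_le _ _).trans hQ
    have hBd : B.natDegree ≤ n + 1 := by
      refine (natDegree_sub_le _ _).trans (max_le ?_ ?_)
      · exact (natDegree_C_mul_le _ _).trans hQ
      · exact (natDegree_C_mul_le _ _).trans hP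
    have hBd' : B.natDegree ≤ n := by
      rw [natDegree_le_iff_coeff_eq_zero] at hBd ⊢
      intro k hk
      rcases Nat.lt_or_ge (n + 1) k with hk' | hk'
      · exact hBd k hk'
      · obtain rfl : k = n + 1 := by omega
        simp only [hB, coeff_sub, coeff_C_mul]
        linear_combination hp
    have heval : ∀ w, w * A.divX.eval w = conj p * P.eval w + conj q * Q.eval w := by
      intro w
      have := congrArg (eval w) hAX
      rw [eval_mul, eval_X] at this
      rw [← this]
      simp [hA]
    have hBe : ∀ w, B.eval w = p * Q.eval w - q * P.eval w := by
      intro w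
      simp [hB]
    have hnorm : ∀ w : ℂ, ‖w‖ = 1 → ‖A.divX.eval w‖ ^ 2 + ‖B.eval w‖ ^ 2 = 1 := by
      intro w hw
      have e1 : ‖A.divX.eval w‖ = ‖conj p * P.eval w + conj q * Q.eval w‖ := by
        rw [← heval, norm_mul, hw, one_mul]
      rw [e1, hBe]
      have h1 : ((‖P.eval w‖ : ℂ)) ^ 2 + (‖Q.eval w‖ : ℂ) ^ 2 = 1 := by exact_mod_cast h w hw
      have goal : ((‖conj p * P.eval w + conj q * Q.eval w‖ : ℂ)) ^ 2
          + (‖p * Q.eval w - q * P.eval w‖ : ℂ) ^ 2 = 1 := by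
        rw [← Complex.mul_conj', ← Complex.mul_conj'] at h1 ⊢
        simp only [map_add, map_sub, map_mul, Complex.conj_conj]
        linear_combination (P.eval w * conj (P.eval w) + Q.eval w * conj (Q.eval w)) * hu' + h1
      exact_mod_cast goal
    obtain ⟨g, hg, hl, he⟩ := ih A.divX B
      (by rw [natDegree_divX_eq_natDegree_tsub_one]; omega) hBd' hnorm
    refine ⟨g ++ [specialGate basisChange, .query 0,
      specialGate ⟨_, SU2.star_mem basisChange.2⟩, specialGate (ofRow p q hu)],
      hg.append ((((IsSpecialWord.nil.cons_special _).cons_special _).cons_query _).cons_special _),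
      by simp [hl]; ring, fun θ => ?_⟩
    obtain ⟨h0, h1⟩ := he θ
    have hword : wordEval (fun _ : Fin 1 => rotX θ) (g ++ [specialGate basisChange, .query 0,
        specialGate ⟨_, SU2.star_mem basisChange.2⟩, specialGate (ofRow p q hu)])
        = wordEval (fun _ => rotX θ) g * (rotZ θ * (ofRow p q hu).1) := by
      simp only [wordEval_append, wordEval_cons, wordEval_nil, ← basisChange_conj_rotX, mul_assoc,
        mul_one]
      rfl
    have hz : Complex.exp (-(Complex.I * θ)) * Complex.exp (Complex.I * θ) = 1 := by
      rw [← Complex.exp_add]; simp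
    rw [hword]
    set z := Complex.exp (Complex.I * θ) with hzdef
    set y := Complex.exp (-(Complex.I * θ)) with hydef
    have hA2 := heval (z ^ 2)
    have hB2 := hBe (z ^ 2)
    constructor
    · rw [Matrix.mul_apply, Fin.sum_univ_two, h0, h1]
      simp only [rotZ, ofRow, Matrix.mul_apply, Fin.sum_univ_two, Matrix.of_apply,
        Matrix.cons_val', Matrix.cons_val_zero, Matrix.cons_val_one, Matrix.cons_val_fin_one,
        zero_mul, add_zero, zero_add, ← hzdef, ← hydef]
      linear_combination (y ^ (n + 1) * p) * hA2 - (y ^ (n + 1) * conj q) * hB2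
        + (y ^ (n + 1) * P.eval (z ^ 2)) * hu' - (y ^ n * z * p * A.divX.eval (z ^ 2)) * hz
    · rw [Matrix.mul_apply, Fin.sum_univ_two, h0, h1]
      simp only [rotZ, ofRow, Matrix.mul_apply, Fin.sum_univ_two, Matrix.of_apply,
        Matrix.cons_val', Matrix.cons_val_zero, Matrix.cons_val_one, Matrix.cons_val_fin_one,
        zero_mul, add_zero, zero_add, ← hzdef, ← hydef]
      linear_combination (y ^ (n + 1) * q) * hA2 + (y ^ (n + 1) * conj p) * hB2
        + (y ^ (n + 1) * Q.eval (z ^ 2)) * hu' - (y ^ n * z * q * A.divX.eval (z ^ 2)) * hz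

/-! ### Nonnegative polynomials in `cos² θ` -/

theorem exp_sq_add_one (θ : ℝ) : Complex.exp (Complex.I * θ) ^ 2 + 1
    = 2 * (Real.cos θ : ℂ) * Complex.exp (Complex.I * θ) := by
  rw [mul_comm Complex.I, Complex.exp_mul_I, Complex.ofReal_cos]
  linear_combination (Complex.sin θ ^ 2) * Complex.I_sq - Complex.cos_sq_add_sin_sq (θ : ℂ)

theorem exp_sq_sub_one (θ : ℝ) : Complex.exp (Complex.I * θ) ^ 2 - 1
    = 2 * Complex.I * (Real.sin θ : ℂ) * Complex.exp (Complex.I * θ) := by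
  rw [mul_comm Complex.I (θ : ℂ), Complex.exp_mul_I, Complex.ofReal_sin]
  linear_combination (-Complex.sin θ ^ 2) * Complex.I_sq + Complex.cos_sq_add_sin_sq (θ : ℂ)

theorem norm_exp_I_mul (θ : ℝ) : ‖Complex.exp (Complex.I * θ)‖ = 1 := by
  rw [mul_comm]; exact Complex.norm_exp_ofReal_mul_I θ

/-- Here cos² θ - r = (1-r) cos² θ + (-r) sin² θ = |u cos θ - i v sin θ|², and e^{iθ} times the
quantity inside the modulus is linear in e^{2iθ}. -/
theorem exists_norm_sq_linear {r : ℝ} (hr : r ≤ 0) : ∃ Q : ℂ[X], Q.natDegree ≤ 1 ∧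
    ∀ θ : ℝ, ‖Q.eval (Complex.exp (Complex.I * θ) ^ 2)‖ ^ 2 = Real.cos θ ^ 2 - r := by
  set u := Real.sqrt (1 - r) with hu
  set v := Real.sqrt (-r) with hv
  have hu2 : u ^ 2 = 1 - r := Real.sq_sqrt (by linarith)
  have hv2 : v ^ 2 = -r := Real.sq_sqrt (by linarith)
  refine ⟨C (((u - v) / 2 : ℝ) : ℂ) * X + C (((u + v) / 2 : ℝ) : ℂ), natDegree_linear_le,
    fun θ => ?_⟩
  have h : eval (Complex.exp (Complex.I * θ) ^ 2)
      (C (((u - v) / 2 : ℝ) : ℂ) * X + C (((u + v) / 2 : ℝ) : ℂ))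
      = Complex.exp (Complex.I * θ)
        * (((u * Real.cos θ : ℝ) : ℂ) + ((-(v * Real.sin θ) : ℝ) : ℂ) * Complex.I) := by
    simp only [eval_add, eval_mul, eval_C, eval_X]
    have h1 := exp_sq_add_one θ
    have h2 := exp_sq_sub_one θ
    push_cast at h1 h2 ⊢
    linear_combination (u / 2 : ℂ) * h1 - (v / 2 : ℂ) * h2
  rw [h, norm_mul, norm_exp_I_mul, one_mul, Complex.sq_norm, Complex.normSq_add_mul_I]
  linear_combination (Real.cos θ ^ 2) * hu2 + Real.sin θ ^ 2 * hv2 - r * Real.sin_sq_add_cos_sq θ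

/-- With w = e^{2iθ} one has 4 w cos² θ = (w+1)², so w (cos² θ - c) is quadratic in w. This handles
a pair of conjugate roots c. -/
theorem exists_norm_sq_quadratic (c : ℂ) : ∃ Q : ℂ[X], Q.natDegree ≤ 2 ∧
    ∀ θ : ℝ, ‖Q.eval (Complex.exp (Complex.I * θ) ^ 2)‖ ^ 2
      = ‖((Real.cos θ ^ 2 : ℝ) : ℂ) - c‖ ^ 2 := by
  refine ⟨C (1 / 4) * X ^ 2 + C (1 / 2 - c) * X + C (1 / 4), natDegree_quadratic_le, fun θ => ?_⟩
  have h : eval (Complex.exp (Complex.I * θ) ^ 2)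
      (C (1 / 4) * X ^ 2 + C (1 / 2 - c) * X + C (1 / 4))
      = Complex.exp (Complex.I * θ) ^ 2 * (((Real.cos θ ^ 2 : ℝ) : ℂ) - c) := by
    simp only [eval_add, eval_mul, eval_C, eval_X, eval_pow]
    have h1 := exp_sq_add_one θ
    push_cast at h1 ⊢
    linear_combination ((Complex.exp (Complex.I * θ) ^ 2 + 1) / 4
      + Complex.cos θ * Complex.exp (Complex.I * θ) / 2) * h1
  rw [h, norm_mul, norm_pow, norm_exp_I_mul, one_pow, one_mul]

/-- A Fejér–Riesz factorization: a real polynomial in `cos² θ` that is positive on `(0, ∞)` is the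
squared modulus of a polynomial in `e^{2iθ}` of the same degree. -/
theorem exists_norm_sq_of_pos (n : ℕ) : ∀ F : ℝ[X], F.natDegree = n →
    (∀ t : ℝ, 0 < t → 0 < F.eval t) → ∃ Q : ℂ[X], Q.natDegree ≤ n ∧
      ∀ θ : ℝ, ‖Q.eval (Complex.exp (Complex.I * θ) ^ 2)‖ ^ 2 = F.eval (Real.cos θ ^ 2) := by
  induction n using Nat.strong_induction_on with
  | _ n ih =>
    intro F hF hpos
    rcases Nat.eq_zero_or_pos n with rfl | hn
    · obtain ⟨r, rfl⟩ := natDegree_eq_zero.1 hF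
      have hr : 0 < r := by simpa using hpos 1 one_pos
      refine ⟨C ((√r : ℝ) : ℂ), by simp, fun θ => ?_⟩
      rw [eval_C, eval_C, Complex.norm_real, Real.norm_of_nonneg (Real.sqrt_nonneg _),
        Real.sq_sqrt hr.le]
    · have hF0 : F ≠ 0 := by rintro rfl; simp at hF; omega
      have hdeg : F.degree ≠ 0 := by rw [degree_eq_natDegree hF0, hF]; exact_mod_cast hn.ne'
      obtain ⟨c, hc⟩ := IsAlgClosed.exists_aeval_eq_zero ℂ F hdeg
      -- Induction step: once a factor D that is nonnegative on (0, ∞) is a squared modulus, the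
      -- cofactor stays positive there. D is linear for a real root, which must be ≤ 0, and
      -- quadratic for a conjugate pair.
      have hsplit : ∀ (D G : ℝ[X]) (Q₁ : ℂ[X]), F = D * G → 0 < D.natDegree →
          (∀ t : ℝ, 0 < t → 0 ≤ D.eval t) → Q₁.natDegree ≤ D.natDegree →
          (∀ θ : ℝ, ‖Q₁.eval (Complex.exp (Complex.I * θ) ^ 2)‖ ^ 2 = D.eval (Real.cos θ ^ 2)) →
          ∃ Q : ℂ[X], Q.natDegree ≤ n ∧ ∀ θ : ℝ,
            ‖Q.eval (Complex.exp (Complex.I * θ) ^ 2)‖ ^ 2 = F.eval (Real.cos θ ^ 2) := by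
        intro D G Q₁ hDG hD hDt hQ₁ hQ₁e
        have hadd : D.natDegree + G.natDegree = n := by
          rw [← hF, hDG, natDegree_mul (left_ne_zero_of_mul (hDG ▸ hF0))
            (right_ne_zero_of_mul (hDG ▸ hF0))]
        obtain ⟨Q₂, hQ₂, hQ₂e⟩ := ih G.natDegree (by omega) G rfl fun t ht => by
          have h := hpos t ht
          rw [hDG, eval_mul] at h
          exact pos_of_mul_pos_right h (hDt t ht)
        refine ⟨Q₁ * Q₂, natDegree_mul_le.trans (by omega), fun θ => ?_⟩
        rw [eval_mul, norm_mul, mul_pow, hQ₁e, hQ₂e, hDG, eval_mul]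
      by_cases him : c.im = 0
      · obtain ⟨r, rfl⟩ : ∃ r : ℝ, c = r := ⟨c.re, Complex.ext rfl (by simpa using him)⟩
        have hroot : F.eval r = 0 := by
          have h : aeval ((algebraMap ℝ ℂ) r) F = 0 := hc
          rw [aeval_algebraMap_apply] at h
          simpa using h
        have hr : r ≤ 0 := by
          by_contra hr
          exact (hpos r (not_le.1 hr)).ne' hroot
        obtain ⟨G, hG⟩ := dvd_iff_isRoot.2 hroot
        obtain ⟨Q₁, hQ₁, hQ₁e⟩ := exists_norm_sq_linear hr
        refine hsplit _ G Q₁ hG (by simp) (fun t ht => ?_) (by simpa using hQ₁) fun θ => ?_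
        · simp; linarith
        · rw [hQ₁e]; simp
      · obtain ⟨G, hG⟩ := F.quadratic_dvd_of_aeval_eq_zero_im_ne_zero hc him
        obtain ⟨Q₁, hQ₁, hQ₁e⟩ := exists_norm_sq_quadratic c
        have hd : (X ^ 2 - C (2 * c.re) * X + C (‖c‖ ^ 2) : ℝ[X]).natDegree = 2 := by
          compute_degree!
        have he : ∀ t : ℝ, (X ^ 2 - C (2 * c.re) * X + C (‖c‖ ^ 2) : ℝ[X]).eval t
            = ‖(t : ℂ) - c‖ ^ 2 := by
          intro t
          simp only [eval_add, eval_sub, eval_mul, eval_pow, eval_X, eval_C, Complex.sq_norm,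
            Complex.normSq_apply, Complex.sub_re, Complex.sub_im, Complex.ofReal_re,
            Complex.ofReal_im]
          ring
        refine hsplit _ G Q₁ hG (by rw [hd]; norm_num) (fun t _ => ?_) (by rw [hd]; exact hQ₁)
          fun θ => ?_
        · rw [he]; positivity
        · rw [hQ₁e, he]

theorem exists_norm_sq_of_coeff_nonneg {F : ℝ[X]} (hF : ∀ k, 0 ≤ F.coeff k) :
    ∃ Q : ℂ[X], Q.natDegree ≤ F.natDegree ∧
      ∀ θ : ℝ, ‖Q.eval (Complex.exp (Complex.I * θ) ^ 2)‖ ^ 2 = F.eval (Real.cos θ ^ 2) := by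
  by_cases h0 : F = 0
  · exact ⟨0, by simp, fun θ => by simp [h0]⟩
  · refine exists_norm_sq_of_pos _ F rfl fun t ht => ?_
    rw [eval_eq_sum, Polynomial.sum_def]
    refine Finset.sum_pos (fun k hk => ?_) (nonempty_support_iff.2 h0)
    exact mul_pos (lt_of_le_of_ne (hF k) (mem_support_iff.1 hk).symm) (pow_pos ht k)

/-- A real polynomial in `cos² θ` as a polynomial in `e^{2iθ}`, up to a phase. -/
theorem exists_eval_cos_sq {f : ℝ[X]} {k : ℕ} (hf : f.natDegree ≤ k) :
    ∃ F : ℂ[X], F.natDegree ≤ 2 * k ∧ ∀ θ : ℝ,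
      F.eval (Complex.exp (Complex.I * θ) ^ 2)
        = Complex.exp (Complex.I * θ) ^ (2 * k) * ((f.eval (Real.cos θ ^ 2) : ℝ) : ℂ) := by
  -- From 4 w cos² θ = (w+1)² with w = e^{2iθ}: w^k cos^{2j} θ = w^{k-j} (w+1)^{2j} / 4^j.
  refine ⟨∑ j ∈ Finset.range (k + 1), C ((f.coeff j : ℝ) / 4 ^ j : ℂ) * (X ^ (k - j)
    * ((X + C 1) ^ 2) ^ j), natDegree_sum_le_of_forall_le _ _ fun j hj => ?_, fun θ => ?_⟩
  · have hj' : j ≤ k := Nat.lt_succ_iff.1 (Finset.mem_range.1 hj)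
    refine (natDegree_C_mul_le _ _).trans (natDegree_mul_le.trans ?_)
    rw [natDegree_X_pow, ← pow_mul]
    have := natDegree_pow_le (p := (X + C 1 : ℂ[X])) (n := 2 * j)
    rw [natDegree_X_add_C] at this
    omega
  · rw [eval_finsetSum, eval_eq_sum_range' (Nat.lt_succ_of_le hf), Complex.ofReal_sum,
      Finset.mul_sum]
    refine Finset.sum_congr rfl fun j hj => ?_
    have hj' : j ≤ k := Nat.lt_succ_iff.1 (Finset.mem_range.1 hj)
    simp only [eval_mul, eval_C, eval_pow, eval_X, eval_add]
    rw [exp_sq_add_one]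
    obtain ⟨i, rfl⟩ := Nat.exists_eq_add_of_le hj'
    rw [Nat.add_sub_cancel_left]
    push_cast
    field_simp
    ring

/-! ### The truncated Taylor series of `cos (arcsin x / 8)` in `x²` -/

/-- The Taylor coefficients of `cos (arcsin x / 8)` in powers of `x²`. -/
noncomputable def cosCoeff : ℕ → ℝ
  | 0 => 1
  | m + 1 => (4 * (m : ℝ) ^ 2 - 1 / 64) / ((2 * m + 2) * (2 * m + 1)) * cosCoeff m

/-- The Taylor polynomial of `cos (arcsin x / 8)` in powers of `x²`. -/
noncomputable def cosPoly : ℕ → ℝ[X]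
  | 0 => 1
  | m + 1 => cosPoly m + C (cosCoeff (m + 1)) * X ^ (m + 1)

theorem cosCoeff_succ (m : ℕ) : (2 * m + 2) * (2 * m + 1) * cosCoeff (m + 1)
    = (4 * (m : ℝ) ^ 2 - 1 / 64) * cosCoeff m := by
  have h : ((2 * m + 2) * (2 * m + 1) : ℝ) ≠ 0 := by positivity
  rw [cosCoeff]
  field_simp

/-- The ratio of consecutive coefficients is negative only at m = 0 and lies in [0, 1] afterwards.
-/
theorem cosCoeff_succ_mem (m : ℕ) : cosCoeff (m + 1) ∈ Set.Icc (-1 : ℝ) 0 := by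
  induction m with
  | zero => norm_num [cosCoeff]
  | succ m ih =>
    have h := cosCoeff_succ (m + 1)
    push_cast at h
    set x := cosCoeff (m + 1)
    set y := cosCoeff (m + 1 + 1)
    have hm : (0 : ℝ) ≤ m := Nat.cast_nonneg m
    obtain ⟨h1, h2⟩ := ih
    have hA : (0 : ℝ) < (2 * (m + 1) + 2) * (2 * (m + 1) + 1) := by positivity
    have hB : (0 : ℝ) ≤ 4 * ((m : ℝ) + 1) ^ 2 - 1 / 64 := by nlinarith
    have hBA : 4 * ((m : ℝ) + 1) ^ 2 - 1 / 64 ≤ (2 * (m + 1) + 2) * (2 * (m + 1) + 1) := by nlinarith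
    constructor
    · by_contra hlt
      push Not at hlt
      nlinarith
    · by_contra hlt
      push Not at hlt
      nlinarith

theorem natDegree_cosPoly_le (m : ℕ) : (cosPoly m).natDegree ≤ m := by
  induction m with
  | zero => simp [cosPoly]
  | succ m ih =>
    exact natDegree_add_le_of_degree_le (ih.trans (Nat.le_succ m)) (natDegree_C_mul_X_pow_le _ _)

theorem coeff_zero_cosPoly (m : ℕ) : (cosPoly m).coeff 0 = 1 := by
  induction m with
  | zero => simp [cosPoly]
  | succ m ih => simp [cosPoly, ih]

theorem coeff_succ_cosPoly_nonpos (m k : ℕ) : (cosPoly m).coeff (k + 1) ≤ 0 := by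
  induction m with
  | zero => simp [cosPoly, coeff_one]
  | succ m ih =>
    simp only [cosPoly, coeff_add, coeff_C_mul, coeff_X_pow]
    split_ifs
    · have := (cosCoeff_succ_mem m).2
      linarith
    · linarith

/-- The residual of the Taylor polynomial in the differential equation of `cos (arcsin x / 8)`. -/
noncomputable def cosResidual (m : ℕ) : ℝ := -(4 * (m : ℝ) ^ 2 - 1 / 64) * cosCoeff m

/-- The function y = cos(arcsin(x)/8) solves (1-x²) y'' - x y' + y/64 = 0, which in t = x² is this
operator set to zero. The coefficient recurrence cancels every term of the truncation except the
last. -/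
theorem cosPoly_ode (m : ℕ) :
    4 * X * (1 - X) * derivative (derivative (cosPoly m)) + (2 - 4 * X) * derivative (cosPoly m)
      + C (1 / 64) * cosPoly m = C (cosResidual m) * X ^ m := by
  induction m with
  | zero => simp [cosPoly, cosResidual, cosCoeff]
  | succ m ih =>
    have hX : (X : ℝ[X]) * derivative (X ^ m) = C (m : ℝ) * X ^ m := by
      cases m with
      | zero => simp
      | succ m => rw [derivative_X_pow_succ]; push_cast; simp; ring
    have hc := congrArg (C : ℝ → ℝ[X]) (cosCoeff_succ m)
    have hr : C (cosResidual m) = -((4 * C (m : ℝ) ^ 2 - C (1 / 64)) * C (cosCoeff m)) := by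
      have h4 : (4 : ℝ[X]) = C 4 := rfl
      rw [h4, ← C_pow, ← C_mul, ← C_sub, ← C_mul, ← C_neg, cosResidual]
      congr 1; ring
    have hr' : C (cosResidual (m + 1))
        = -((4 * (C (m : ℝ) + 1) ^ 2 - C (1 / 64)) * C (cosCoeff (m + 1))) := by
      have h4 : (4 : ℝ[X]) = C 4 := rfl
      have h1 : (1 : ℝ[X]) = C 1 := rfl
      rw [h4, h1, ← C_add, ← C_pow, ← C_mul, ← C_sub, ← C_mul, ← C_neg, cosResidual]
      congr 1; push_cast; ring
    have hc' : (2 * C (m : ℝ) + 2) * (2 * C (m : ℝ) + 1) * C (cosCoeff (m + 1))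
        = (4 * C (m : ℝ) ^ 2 - C (1 / 64)) * C (cosCoeff m) := by
      have h4 : (4 : ℝ[X]) = C 4 := rfl
      have h2 : (2 : ℝ[X]) = C 2 := rfl
      have h1 : (1 : ℝ[X]) = C 1 := rfl
      rw [h4, h2, h1, ← C_pow, ← C_mul, ← C_mul, ← C_sub, ← C_mul, ← C_add, ← C_add, ← C_mul,
        ← C_mul]
      exact hc
    rw [hr] at ih
    rw [hr', cosPoly]
    simp only [derivative_add, derivative_X_pow_succ, derivative_mul, derivative_C, zero_mul,
      zero_add]
    have hn : C ((m : ℝ) + 1) = C (m : ℝ) + 1 := by simp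
    simp only [hn]
    linear_combination ih + (4 * (1 - X) * C (cosCoeff (m + 1)) * (C (m : ℝ) + 1)) * hX
      + X ^ m * hc'

/-- The squared modulus of `cosPoly` completed by its derivative. -/
noncomputable def cosModulus (m : ℕ) : ℝ[X] :=
  cosPoly m ^ 2 + C 256 * (X * (1 - X) * derivative (cosPoly m) ^ 2)

/-- The weight 256 makes this derivative 128 p' times the left side of `cosPoly_ode`, where p =
`cosPoly m`. -/
theorem derivative_cosModulus (m : ℕ) : derivative (cosModulus m)
    = C (128 * cosResidual m) * (derivative (cosPoly m) * X ^ m) := by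
  have h := cosPoly_ode m
  have e1 : C (128 * cosResidual m) = 128 * C (cosResidual m) := by
    rw [C_mul]; rfl
  have e2 : (C 256 : ℝ[X]) = 256 := rfl
  have e3 : 64 * C (1 / 64 : ℝ) = 1 := by
    change C 64 * C (1 / 64 : ℝ) = C 1
    rw [← C_mul]; norm_num
  rw [e1, cosModulus, e2]
  simp only [derivative_add, derivative_mul, derivative_pow, derivative_X, derivative_sub,
    derivative_one, derivative_ofNat]
  simp only [Nat.cast_ofNat, map_ofNat]
  linear_combination (128 * derivative (cosPoly m)) * h
    - (2 * derivative (cosPoly m) * cosPoly m) * e3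

theorem natDegree_cosModulus_le {m : ℕ} (hm : 1 ≤ m) : (cosModulus m).natDegree ≤ 2 * m := by
  have h := natDegree_cosPoly_le m
  have h' : (derivative (cosPoly m)).natDegree ≤ m - 1 :=
    (natDegree_derivative_le _).trans (Nat.sub_le_sub_right h 1)
  refine natDegree_add_le_of_degree_le ((natDegree_pow_le).trans (by omega)) ?_
  refine (natDegree_C_mul_le _ _).trans (natDegree_mul_le.trans ?_)
  have h1 : (X * (1 - X) : ℝ[X]).natDegree ≤ 2 := by compute_degree
  have h2 : (derivative (cosPoly m) ^ 2).natDegree ≤ 2 * (m - 1) :=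
    natDegree_pow_le.trans (by omega)
  omega

theorem cosResidual_mem {m : ℕ} (hm : 1 ≤ m) :
    cosResidual m ∈ Set.Icc (0 : ℝ) (4 * (m : ℝ) ^ 2) := by
  obtain ⟨k, rfl⟩ := Nat.exists_eq_add_of_le' hm
  obtain ⟨h1, h2⟩ := cosCoeff_succ_mem k
  have hk : (1 : ℝ) ≤ ((k + 1 : ℕ) : ℝ) := by exact_mod_cast hm
  unfold cosResidual
  have hB : (0 : ℝ) ≤ 4 * ((k + 1 : ℕ) : ℝ) ^ 2 - 1 / 64 := by nlinarith
  constructor <;> nlinarith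

/-- The modulus has constant term 1. Its derivative is a nonnegative residual times t^m times p',
whose coefficients are all nonpositive. -/
theorem coeff_one_sub_cosModulus_nonneg {m : ℕ} (hm : 1 ≤ m) (k : ℕ) :
    0 ≤ (1 - cosModulus m).coeff k := by
  cases k with
  | zero =>
    have h : (cosModulus m).coeff 0 = 1 := by
      rw [coeff_zero_eq_eval_zero, cosModulus]
      simp [← coeff_zero_eq_eval_zero, coeff_zero_cosPoly]
    rw [coeff_sub, h, coeff_one_zero, sub_self]
  | succ k =>
    have h := congrArg (fun p => p.coeff k) (derivative_cosModulus m)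
    simp only [coeff_derivative, coeff_C_mul, coeff_mul_X_pow'] at h
    have hk : (0 : ℝ) < (k : ℝ) + 1 := by positivity
    have hle : (cosModulus m).coeff (k + 1) * ((k : ℝ) + 1) ≤ 0 := by
      rw [h]
      refine mul_nonpos_of_nonneg_of_nonpos
        (mul_nonneg (by norm_num) (cosResidual_mem hm).1) ?_
      split_ifs
      · exact mul_nonpos_of_nonpos_of_nonneg (coeff_succ_cosPoly_nonpos _ _) (by positivity)
      · exact le_rfl
    rw [coeff_sub, coeff_one, if_neg (Nat.succ_ne_zero k), zero_sub]
    have := nonpos_of_mul_nonpos_left hle hk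
    linarith

/-! ### The approximation of `e^{i(θ/8 - π/16)}` -/

/-- The approximation of `e^{i(θ/8 - π/16)}` by a trigonometric polynomial. -/
noncomputable def phaseApprox (m : ℕ) (θ : ℝ) : ℂ :=
  (((cosPoly m).eval (Real.cos θ ^ 2) : ℝ) : ℂ)
    + ((16 * (Real.sin θ * Real.cos θ * (derivative (cosPoly m)).eval (Real.cos θ ^ 2)) : ℝ) : ℂ)
      * Complex.I

theorem norm_phaseApprox_sq (m : ℕ) (θ : ℝ) :
    ‖phaseApprox m θ‖ ^ 2 = (cosModulus m).eval (Real.cos θ ^ 2) := by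
  rw [phaseApprox, Complex.sq_norm, Complex.normSq_add_mul_I, cosModulus]
  simp only [eval_add, eval_mul, eval_pow, eval_C, eval_X, eval_sub, eval_one]
  linear_combination (256 * Real.cos θ ^ 2
    * (derivative (cosPoly m)).eval (Real.cos θ ^ 2) ^ 2) * Real.sin_sq_add_cos_sq θ

/-- For the exact phase this product would be constant. The real part of the equation F' = iF/8
holds exactly by the choice of the imaginary part of F, and the imaginary part fails only by the
residual in `cosPoly_ode`. -/
theorem hasDerivAt_phaseApprox_mul (m : ℕ) (θ : ℝ) :
    HasDerivAt (fun t : ℝ => phaseApprox m t * Complex.exp (-((t / 8 : ℝ) * Complex.I)))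
      (-(8 * cosResidual m * (Real.cos θ ^ 2) ^ m : ℝ) * Complex.I
        * Complex.exp (-((θ / 8 : ℝ) * Complex.I))) θ := by
  have hc : HasDerivAt (fun t : ℝ => Real.cos t ^ 2) (-(2 * Real.sin θ * Real.cos θ)) θ := by
    refine ((Real.hasDerivAt_cos θ).pow 2).congr_deriv ?_
    simp; ring
  have hu : HasDerivAt (fun t : ℝ => (cosPoly m).eval (Real.cos t ^ 2))
      ((derivative (cosPoly m)).eval (Real.cos θ ^ 2) * -(2 * Real.sin θ * Real.cos θ)) θ :=
    HasDerivAt.comp (h₂ := fun t => (cosPoly m).eval t) θ ((cosPoly m).hasDerivAt _) hc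
  have hd : HasDerivAt (fun t : ℝ => (derivative (cosPoly m)).eval (Real.cos t ^ 2))
      ((derivative (derivative (cosPoly m))).eval (Real.cos θ ^ 2)
        * -(2 * Real.sin θ * Real.cos θ)) θ :=
    HasDerivAt.comp (h₂ := fun t => (derivative (cosPoly m)).eval t) θ
      ((derivative (cosPoly m)).hasDerivAt _) hc
  have hv := ((((Real.hasDerivAt_sin θ).mul (Real.hasDerivAt_cos θ)).mul hd).const_mul 16)
  have he : HasDerivAt (fun t : ℝ => Complex.exp (-((t / 8 : ℝ) * Complex.I)))
      (Complex.exp (-((θ / 8 : ℝ) * Complex.I)) * -((1 / 8 : ℝ) * Complex.I)) θ :=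
    ((((hasDerivAt_id θ).div_const 8).ofReal_comp.mul_const Complex.I).neg).cexp
  have hall := ((hu.ofReal_comp.add (hv.ofReal_comp.mul_const Complex.I)).mul he)
  refine hall.congr_deriv ?_
  have hode := congrArg (eval (Real.cos θ ^ 2)) (cosPoly_ode m)
  simp only [eval_add, eval_mul, eval_pow, eval_C, eval_X, eval_sub, eval_one, eval_ofNat] at hode
  have hode' := congrArg (fun x : ℝ => (x : ℂ)) hode
  have hs := congrArg (fun x : ℝ => (x : ℂ)) (Real.sin_sq_add_cos_sq θ)
  simp only [Pi.mul_apply, Pi.add_apply]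
  push_cast at hode' hs ⊢
  generalize Complex.exp (-((θ : ℂ) / 8 * Complex.I)) = E
  generalize ((eval (Real.cos θ ^ 2) (cosPoly m) : ℝ) : ℂ) = c0 at *
  generalize ((eval (Real.cos θ ^ 2) (derivative (cosPoly m)) : ℝ) : ℂ) = c1 at *
  generalize ((eval (Real.cos θ ^ 2) (derivative (derivative (cosPoly m))) : ℝ) : ℂ) = c2 at *
  linear_combination (-8 * Complex.I * E) * hode'
    - (2 * Complex.sin θ * Complex.cos θ * c1 * E) * Complex.I_sq
    + (-16 * c1 * Complex.I * E - 32 * Complex.I * E * Complex.cos θ ^ 2 * c2) * hs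

/-- The approximation is exact at θ = π/2, so the mean value inequality applies from there. The
derivative is at most 8 · 4m² · (1-δ)^{2m}, and the path has length at most π/2 ≤ 2. -/
theorem norm_phaseApprox_sub_le {m : ℕ} (hm : 1 ≤ m) {δ : ℝ} (hδ : 0 ≤ δ) (hδ' : δ ≤ 1) {x : ℝ}
    (hx : x ∈ Set.Icc (-1 + δ) (1 - δ)) :
    ‖phaseApprox m (Real.arccos x)
        - Complex.exp (((Real.arccos x / 8 - Real.pi / 16 : ℝ) : ℂ) * Complex.I)‖
      ≤ 64 * (m : ℝ) ^ 2 * (1 - δ) ^ (2 * m) := by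
  set a := Real.arccos (1 - δ) with ha
  set f : ℝ → ℂ := fun t => phaseApprox m t * Complex.exp (-((t / 8 : ℝ) * Complex.I)) with hf
  have hmem : ∀ y ∈ Set.Icc (-1 + δ) (1 - δ), Real.arccos y ∈ Set.Icc a (Real.pi - a) := by
    intro y hy
    refine ⟨Real.arccos_le_arccos hy.2, ?_⟩
    rw [ha, ← Real.arccos_neg]
    exact Real.arccos_le_arccos (by linarith [hy.1])
  obtain ⟨hr0, hr1⟩ := cosResidual_mem hm
  have hbound : ∀ t ∈ Set.Icc a (Real.pi - a),
      ‖(-(8 * cosResidual m * (Real.cos t ^ 2) ^ m : ℝ) * Complex.I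
        * Complex.exp (-((t / 8 : ℝ) * Complex.I)) : ℂ)‖ ≤ 32 * (m : ℝ) ^ 2 * (1 - δ) ^ (2 * m) := by
    intro t ht
    have ha0 : 0 ≤ a := Real.arccos_nonneg _
    have hca : Real.cos a = 1 - δ := Real.cos_arccos (by linarith) (by linarith)
    have h1 : Real.cos t ≤ 1 - δ := by
      rw [← hca]
      exact Real.cos_le_cos_of_nonneg_of_le_pi ha0 (by linarith [ht.2]) ht.1
    have h2 : -(1 - δ) ≤ Real.cos t := by
      rw [← hca, ← Real.cos_pi_sub]
      exact Real.cos_le_cos_of_nonneg_of_le_pi (by linarith [ht.1]) (by linarith) ht.2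
    have hsq : Real.cos t ^ 2 ≤ (1 - δ) ^ 2 := sq_le_sq' h2 h1
    have hexp : ‖Complex.exp (-((t / 8 : ℝ) * Complex.I))‖ = 1 := by
      rw [← neg_mul, ← Complex.ofReal_neg]
      exact Complex.norm_exp_ofReal_mul_I _
    rw [norm_mul, norm_mul, norm_neg, Complex.norm_real, Complex.norm_I, hexp, mul_one, mul_one,
      Real.norm_of_nonneg (by positivity), pow_mul]
    have hp : (Real.cos t ^ 2) ^ m ≤ ((1 - δ) ^ 2) ^ m := pow_le_pow_left₀ (sq_nonneg _) hsq m
    calc 8 * cosResidual m * (Real.cos t ^ 2) ^ m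
        ≤ 8 * (4 * (m : ℝ) ^ 2) * ((1 - δ) ^ 2) ^ m := by gcongr
      _ = 32 * (m : ℝ) ^ 2 * ((1 - δ) ^ 2) ^ m := by ring
  have hmid : Real.pi / 2 ∈ Set.Icc a (Real.pi - a) := by
    have := hmem 0 ⟨by linarith, by linarith⟩
    rwa [Real.arccos_zero] at this
  have hlip := (convex_Icc a (Real.pi - a)).norm_image_sub_le_of_norm_hasDerivWithin_le
    (f := f) (fun t _ => (hasDerivAt_phaseApprox_mul m t).hasDerivWithinAt) hbound hmid
    (hmem x hx)
  have hmidval : f (Real.pi / 2) = Complex.exp (-((Real.pi / 16 : ℝ) * Complex.I)) := by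
    simp only [hf, phaseApprox, Real.cos_pi_div_two]
    rw [zero_pow two_ne_zero, ← coeff_zero_eq_eval_zero, coeff_zero_cosPoly]
    simp
    ring_nf
  have hfac : phaseApprox m (Real.arccos x)
      - Complex.exp (((Real.arccos x / 8 - Real.pi / 16 : ℝ) : ℂ) * Complex.I)
      = (f (Real.arccos x) - f (Real.pi / 2))
        * Complex.exp ((Real.arccos x / 8 : ℝ) * Complex.I) := by
    rw [hmidval, sub_mul, ← Complex.exp_add]
    simp only [hf]
    rw [mul_assoc, ← Complex.exp_add, neg_add_cancel, Complex.exp_zero, mul_one]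
    congr 2
    push_cast
    ring
  rw [hfac, norm_mul, Complex.norm_exp_ofReal_mul_I, mul_one]
  refine hlip.trans ?_
  have habs : ‖Real.arccos x - Real.pi / 2‖ ≤ 2 := by
    have h1 := Real.arccos_nonneg x
    have h2 := Real.arccos_le_pi x
    have h3 := Real.pi_le_four
    rw [Real.norm_eq_abs, abs_le]
    constructor <;> linarith
  have hnn : 0 ≤ 32 * (m : ℝ) ^ 2 * (1 - δ) ^ (2 * m) := by
    have : 0 ≤ 1 - δ := by linarith
    positivity
  calc _ ≤ 32 * (m : ℝ) ^ 2 * (1 - δ) ^ (2 * m) * 2 := mul_le_mul_of_nonneg_left habs hnn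
    _ = _ := by ring

/-! ### The gadget for the inverse of `T₄` -/

/-- The phase approximation is implemented by a word with `2m` queries. -/
theorem exists_word_phaseApprox {m : ℕ} (hm : 1 ≤ m) :
    ∃ g : List (Gate 1), IsSpecialWord g ∧ g.length = 8 * m + 1 ∧
      ∀ θ : ℝ, wordEval (fun _ => rotX θ) g 0 0 = phaseApprox m θ := by
  obtain ⟨F, hF, hFe⟩ := exists_eval_cos_sq (natDegree_cosPoly_le m)
  obtain ⟨D, hD, hDe⟩ := exists_eval_cos_sq (f := derivative (cosPoly m)) (k := m - 1)
    ((natDegree_derivative_le _).trans (Nat.sub_le_sub_right (natDegree_cosPoly_le m) 1))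
  obtain ⟨Q, hQ, hQe⟩ := exists_norm_sq_of_coeff_nonneg (coeff_one_sub_cosModulus_nonneg hm)
  have hQd : Q.natDegree ≤ 2 * m := hQ.trans <| (natDegree_sub_le _ _).trans
    (max_le (by simp) (natDegree_cosModulus_le hm))
  -- With w = e^{2iθ}, w² - 1 = 4i sin θ cos θ · w. The factor 4 therefore yields the 16 i sin θ cos
  -- θ of `phaseApprox`, and the extra w raises w^{m-1} to w^m.
  set P : ℂ[X] := F + C 4 * ((X ^ 2 - C 1) * D) with hP
  have hPd : P.natDegree ≤ 2 * m := by
    refine natDegree_add_le_of_degree_le hF ((natDegree_C_mul_le _ _).trans ?_)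
    refine natDegree_mul_le.trans ?_
    rw [natDegree_X_pow_sub_C]
    omega
  have hPe : ∀ θ : ℝ, P.eval (Complex.exp (Complex.I * θ) ^ 2)
      = Complex.exp (Complex.I * θ) ^ (2 * m) * phaseApprox m θ := by
    intro θ
    obtain ⟨k, rfl⟩ := Nat.exists_eq_add_of_le' hm
    have h1 := exp_sq_add_one θ
    have h2 := exp_sq_sub_one θ
    simp only [hP, eval_add, eval_mul, eval_C, eval_sub, eval_pow, eval_X, hFe, hDe,
      Nat.add_sub_cancel, phaseApprox]
    push_cast at h1 h2 ⊢
    generalize Complex.exp (Complex.I * θ) = z at *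
    generalize ((eval (Real.cos θ ^ 2) (derivative (cosPoly (k + 1))) : ℝ) : ℂ) = d
    generalize ((eval (Real.cos θ ^ 2) (cosPoly (k + 1)) : ℝ) : ℂ) = c
    have h3 : (z ^ 2) ^ 2 - 1 = 4 * Complex.I * Complex.sin θ * Complex.cos θ * z ^ 2 := by
      linear_combination (z ^ 2 - 1) * h1 + 2 * Complex.cos θ * z * h2
    linear_combination (4 * z ^ (2 * k) * d) * h3
  have hnorm : ∀ w : ℂ, ‖w‖ = 1 → ‖P.eval w‖ ^ 2 + ‖Q.eval w‖ ^ 2 = 1 := by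
    intro w hw
    have hwe : w = Complex.exp (Complex.I * ((w.arg / 2 : ℝ) : ℂ)) ^ 2 := by
      have h := Complex.norm_mul_exp_arg_mul_I w
      rw [hw, Complex.ofReal_one, one_mul] at h
      rw [← Complex.exp_nat_mul]
      refine h.symm.trans (congrArg Complex.exp ?_)
      push_cast
      ring
    rw [hwe, hPe, hQe, norm_mul, norm_pow, norm_exp_I_mul, one_pow, one_mul, norm_phaseApprox_sq]
    simp
  obtain ⟨g, hg, hl, he⟩ := exists_word_of_unit_row (2 * m) P Q hPd hQd hnorm
  refine ⟨g, hg, by rw [hl]; ring, fun θ => ?_⟩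
  rw [(he θ).1, hPe, ← mul_assoc, ← mul_pow, ← Complex.exp_add, neg_add_cancel, Complex.exp_zero,
    one_pow, one_mul]

/-- With first row (a, b) and d = |a - e^{iψ}|, both |b|² = 1 - |a|² and d² are at most 2d. This is
where a square root of the error is lost. -/
theorem SU2.norm_sub_rotZ_sq_le {U : QubitOp} (hU : U ∈ SU2) (ψ : ℝ) :
    ‖U - rotZ ψ‖ ^ 2 ≤ 4 * ‖U 0 0 - Complex.exp (ψ * Complex.I)‖ := by
  have h00 : rotZ ψ 0 0 = Complex.exp (ψ * Complex.I) := by simp [rotZ, mul_comm]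
  have h01 : rotZ ψ 0 1 = 0 := rfl
  rw [SU2.norm_sub_sq hU (rotZ_mem_SU2 ψ), h00, h01, sub_zero]
  have h3 := (mem_SU2_iff.1 hU).2.2
  rw [Complex.mul_conj', Complex.mul_conj'] at h3
  have h1 : ‖U 0 0‖ ^ 2 + ‖U 0 1‖ ^ 2 = 1 := by exact_mod_cast h3
  have he : ‖Complex.exp (ψ * Complex.I)‖ = 1 := Complex.norm_exp_ofReal_mul_I ψ
  have h2 := norm_sub_norm_le (Complex.exp (ψ * Complex.I)) (U 0 0)
  rw [norm_sub_rev, he] at h2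
  have h4 := norm_sub_le (U 0 0) (Complex.exp (ψ * Complex.I))
  rw [he] at h4
  have h5 : ‖U 0 0‖ ≤ 1 := by nlinarith [norm_nonneg (U 0 0), sq_nonneg ‖U 0 1‖]
  nlinarith [norm_nonneg (U 0 0), norm_nonneg (U 0 0 - Complex.exp (ψ * Complex.I))]

/-- A word approximating `e^{iθσ_x/4}` with values that are reflection invariant. -/
theorem exists_word_quarter_rotation {m : ℕ} (hm : 1 ≤ m) :
    ∃ r : List (Gate 1), IsSpecialWord r ∧ r.length = 16 * m + 8 ∧
      (∀ U : Fin 1 → QubitOp, (∀ j, pauliFlip (U j) = U j) →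
        pauliFlip (wordEval U r) = wordEval U r) ∧
      ∀ δ : ℝ, 0 ≤ δ → δ ≤ 1 → ∀ x ∈ Set.Icc (-1 + δ) (1 - δ),
        ‖wordEval (fun _ => rotX (Real.arccos x)) r - rotX (Real.arccos x / 4)‖
          ≤ 4 * √(64 * (m : ℝ) ^ 2 * (1 - δ) ^ (2 * m)) := by
  obtain ⟨g, hg, hl, he⟩ := exists_word_phaseApprox hm
  have hs := SU2.star_mem basisChange.2
  -- The basis change turns the z-rotation by θ/8 - π/16 into an x-rotation, and `rotX (π/16)`
  -- removes the offset.
  set k : List (Gate 1) := specialGate ⟨_, rotX_mem_SU2 (Real.pi / 16)⟩ :: specialGate ⟨_, hs⟩ ::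
    (g ++ [specialGate basisChange]) with hk
  have hks : IsSpecialWord k :=
    ((hg.append (IsSpecialWord.nil.cons_special _)).cons_special _).cons_special _
  obtain ⟨k', hl', hks', hke'⟩ := hks.exists_mirror
  -- A mirror word times the word is flip-invariant, and it doubles the angle θ/8 to θ/4.
  refine ⟨k' ++ k, hks'.append hks, by simp [hl', hk, hl]; ring, fun U hU => ?_, ?_⟩
  · rw [wordEval_append, hke' U hU, pauliFlip_mul, pauliFlip_pauliFlip]
  · intro δ hδ hδ' x hx
    set θ := Real.arccos x with hθ
    set κ := 64 * (m : ℝ) ^ 2 * (1 - δ) ^ (2 * m) with hκ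
    have hU : ∀ j : Fin 1, (fun _ => rotX θ) j ∈ SU2 := fun _ => rotX_mem_SU2 θ
    have hgm := hg.wordEval_mem hU
    set M := wordEval (fun _ : Fin 1 => rotX θ) g with hM
    have hMe : ‖M - rotZ (θ / 8 - Real.pi / 16)‖ ≤ 2 * √κ := by
      have h := SU2.norm_sub_rotZ_sq_le hgm (θ / 8 - Real.pi / 16)
      rw [hM, he θ] at h
      have h' := norm_phaseApprox_sub_le hm hδ hδ' hx
      have hκ0 : 0 ≤ κ := (norm_nonneg _).trans h'
      refine le_of_sq_le_sq ?_ (by positivity)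
      rw [mul_pow, Real.sq_sqrt hκ0]
      linarith
    have hkv : wordEval (fun _ : Fin 1 => rotX θ) k
        = rotX (Real.pi / 16) * (star basisChange.1 * (M * basisChange.1)) := by
      simp only [hk, wordEval_append, wordEval_cons, wordEval_nil, mul_one]
      rfl
    have hid : rotX (θ / 8) = rotX (Real.pi / 16)
        * (star basisChange.1 * (rotZ (θ / 8 - Real.pi / 16) * basisChange.1)) := by
      rw [← basisChange_conj_rotX, mul_assoc, SU2.star_mul basisChange.2, mul_one,
        ← mul_assoc (star _), SU2.star_mul basisChange.2, one_mul, rotX_mul_rotX]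
      congr 1
      ring
    have hke : ‖wordEval (fun _ : Fin 1 => rotX θ) k - rotX (θ / 8)‖ ≤ 2 * √κ := by
      rw [hkv, hid, ← mul_sub, SU2.norm_mul (rotX_mem_SU2 _), ← mul_sub, SU2.norm_mul hs,
        ← sub_mul, SU2.mul_norm basisChange.2]
      exact hMe
    have hkm := hks.wordEval_mem hU
    have hquart : rotX (θ / 4) = pauliFlip (rotX (θ / 8)) * rotX (θ / 8) := by
      rw [pauliFlip_rotX, rotX_mul_rotX]
      congr 1
      ring
    rw [wordEval_append, hke' _ (fun _ => pauliFlip_rotX θ), hquart]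
    refine (SU2.norm_mul_sub_mul_le (pauliFlip_mem_SU2 hkm) (rotX_mem_SU2 _)).trans ?_
    rw [norm_pauliFlip_sub hkm (rotX_mem_SU2 _)]
    linarith

/-! ### Choice of the degree -/

theorem one_le_log_rate {δ ε : ℝ} (hδ : 0 < δ) (hδ' : δ ≤ 1) (hε : 0 < ε) (hε' : ε ≤ 1 / 2) :
    1 ≤ Real.log ((ε ^ 2)⁻¹ * δ ^ (-(1 / 4) : ℝ)) := by
  have h1 : (4 : ℝ) ≤ (ε ^ 2)⁻¹ := by
    rw [le_inv_comm₀ (by norm_num) (by positivity)]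
    nlinarith
  have h2 : (1 : ℝ) ≤ δ ^ (-(1 / 4) : ℝ) :=
    Real.one_le_rpow_of_pos_of_le_one_of_nonpos hδ hδ' (by norm_num)
  have h3 : (4 : ℝ) ≤ (ε ^ 2)⁻¹ * δ ^ (-(1 / 4) : ℝ) := by nlinarith
  rw [Real.le_log_iff_exp_le (by linarith)]
  linarith [Real.exp_one_lt_d9]

theorem exp_neg_log_rate {δ ε : ℝ} (hδ : 0 < δ) (hε : 0 < ε) :
    Real.exp (-(16 * Real.log ((ε ^ 2)⁻¹ * δ ^ (-(1 / 4) : ℝ)))) = ε ^ 32 * δ ^ 4 := by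
  have hpos : 0 < (ε ^ 2)⁻¹ * δ ^ (-(1 / 4) : ℝ) := by positivity
  have h : (δ ^ (-(1 / 4) : ℝ)) ^ 16 = (δ ^ 4)⁻¹ := by
    rw [← Real.rpow_natCast, ← Real.rpow_mul hδ.le, ← Real.rpow_natCast, ← Real.rpow_neg hδ.le]
    norm_num
  rw [Real.exp_neg, show (16 : ℝ) = ((16 : ℕ) : ℝ) by norm_num, Real.exp_nat_mul,
    Real.exp_log hpos, mul_pow, h]
  field_simp

theorem exists_degree {δ ε : ℝ} (hδ : 0 < δ) (hδ' : δ ≤ 1) (hε : 0 < ε) (hε' : ε ≤ 1 / 2) :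
    ∃ m : ℕ, 1 ≤ m ∧ (m : ℝ) ≤ 17 * rate δ ε ∧
      48 * √(64 * (m : ℝ) ^ 2 * (1 - δ) ^ (2 * m)) ≤ ε := by
  have hl := one_le_log_rate hδ hδ' hε hε'
  have hexp := exp_neg_log_rate hδ hε
  unfold rate
  set l := Real.log ((ε ^ 2)⁻¹ * δ ^ (-(1 / 4) : ℝ)) with hldef
  have hδi : 1 ≤ δ⁻¹ := (one_le_inv₀ hδ).2 hδ'
  have hrate : 1 ≤ δ⁻¹ * l := by nlinarith
  -- The factor 16 turns δ^{-1/4} into δ⁴, enough to absorb the δ⁻² that appears when m is written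
  -- as y/δ.
  set m := ⌈16 * (δ⁻¹ * l)⌉₊ with hm
  have hm1 : 16 * (δ⁻¹ * l) ≤ m := Nat.le_ceil _
  have hm2 : (m : ℝ) < 16 * (δ⁻¹ * l) + 1 := Nat.ceil_lt_add_one (by linarith)
  refine ⟨m, ?_, by linarith, ?_⟩
  · have : (1 : ℝ) ≤ m := by linarith
    exact_mod_cast this
  set y := δ * m with hy
  have hy16 : 16 * l ≤ y := by
    have := mul_le_mul_of_nonneg_left hm1 hδ.le
    rw [show δ * (16 * (δ⁻¹ * l)) = 16 * l * (δ * δ⁻¹) by ring, mul_inv_cancel₀ hδ.ne'] at this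
    linarith
  have hy0 : 0 ≤ y := by linarith
  have hquad := Real.quadratic_le_exp_of_nonneg hy0
  -- One of the two factors e^{-y} that bound (1-δ)^{2m} is spent on y², and the other gives the
  -- decay.
  have hy2 : y ^ 2 ≤ 2 * Real.exp y := by nlinarith
  have hpow : (1 - δ) ^ (2 * m) ≤ Real.exp (-y) * Real.exp (-y) := by
    have h1 : 1 - δ ≤ Real.exp (-δ) := by linarith [Real.add_one_le_exp (-δ)]
    refine (pow_le_pow_left₀ (by linarith) h1 _).trans (le_of_eq ?_)
    rw [← Real.exp_nat_mul, ← Real.exp_add]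
    congr 1
    push_cast
    rw [hy]
    ring
  have hexpy : Real.exp (-y) ≤ ε ^ 32 * δ ^ 4 := by
    rw [← hexp]
    exact Real.exp_le_exp.2 (by linarith)
  have hee : Real.exp y * Real.exp (-y) = 1 := by rw [← Real.exp_add]; simp
  have hmy : (m : ℝ) ^ 2 * δ ^ 2 = y ^ 2 := by rw [hy]; ring
  have hmul : (64 * (m : ℝ) ^ 2 * (1 - δ) ^ (2 * m)) * δ ^ 2 ≤ 128 * (ε ^ 32 * δ ^ 4) := by
    calc (64 * (m : ℝ) ^ 2 * (1 - δ) ^ (2 * m)) * δ ^ 2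
        = 64 * y ^ 2 * (1 - δ) ^ (2 * m) := by rw [← hmy]; ring
      _ ≤ 64 * (2 * Real.exp y) * (Real.exp (-y) * Real.exp (-y)) := by
          have : 0 ≤ (1 - δ) ^ (2 * m) := pow_nonneg (by linarith) _
          gcongr
      _ = 128 * Real.exp (-y) := by linear_combination (128 * Real.exp (-y)) * hee
      _ ≤ _ := by linarith
  have hε30 : ε ^ 30 ≤ (1 / 2) ^ 30 := pow_le_pow_left₀ hε.le hε' 30
  have hκ : 64 * (m : ℝ) ^ 2 * (1 - δ) ^ (2 * m) ≤ (ε / 48) ^ 2 := by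
    refine le_of_mul_le_mul_right (hmul.trans ?_) (pow_pos hδ 2)
    have hδ2 : δ ^ 2 ≤ 1 := pow_le_one₀ hδ.le hδ'
    calc 128 * (ε ^ 32 * δ ^ 4) = 128 * ε ^ 30 * ε ^ 2 * δ ^ 2 * δ ^ 2 := by ring
      _ ≤ 128 * (1 / 2) ^ 30 * ε ^ 2 * 1 * δ ^ 2 := by gcongr
      _ ≤ (ε / 48) ^ 2 * δ ^ 2 := by
          have : 0 ≤ ε ^ 2 * δ ^ 2 := by positivity
          rw [div_pow]
          norm_num
          nlinarith
  have := Real.sqrt_le_sqrt hκ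
  rw [Real.sqrt_sq (by positivity)] at this
  linarith

end QSPGadget

open scoped Matrix.Norms.L2Operator in
/-- Arbitrary approximate addition: a fixed gadget `S` achieves `(T_4(x_0) + T_4(x_1)) / 2`, and
with an absolute constant `K`, for all `δ`, `ε` there is a gadget `R` for the inverse of `T_4` such
that feeding the two inputs through copies of `R` into `S` yields an ancilla-free `(2, 1)` gadget
that `ε`-approximately achieves `(x_0 + x_1) / 2` within the stated cost and depth. -/
theorem mainTheorem7 :
    ∃ S : QSPGadget.Circuit 2 1,
      QSPGadget.IsGadget S.toSuperOp ∧
      QSPGadget.Achieves S.toSuperOp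
        (fun x _ => (QSPGadget.chebT4 (x 0) + QSPGadget.chebT4 (x 1)) / 2)
        (QSPGadget.cube 2 0) ∧
      ∃ K : ℝ, 0 < K ∧
        ∀ δ ε : ℝ, 0 < δ → δ ≤ 1 → 0 < ε → ε ≤ 1 / 2 →
          ∃ (R : QSPGadget.Circuit 1 1) (G : QSPGadget.Circuit 2 1),
            QSPGadget.IsGadget R.toSuperOp ∧
            QSPGadget.ApproxAchieves ε R.toSuperOp
              (fun x _ => QSPGadget.invChebT4 (x 0)) (QSPGadget.cube 1 δ) ∧
            G = S.comp (R.copies 2) ∧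
            QSPGadget.IsGadget G.toSuperOp ∧
            QSPGadget.ApproxAchieves ε G.toSuperOp
              (fun x _ => (x 0 + x 1) / 2) (QSPGadget.cube 2 δ) ∧
            (G.cost 0 : ℝ) ≤ K * QSPGadget.rate δ ε ∧
            (G.depth 0 : ℝ) ≤ K * QSPGadget.rate δ ε := by
  open QSPGadget in
  refine ⟨meanT4, fun U hU k => isTwistedEmbeddable_meanT4
    (fun j => (hU j).isTwistedEmbeddable) k, ?_, 5000, by norm_num, ?_⟩
  · intro x hx k
    have hT : ∀ j, chebT4 (x j) = Real.cos (4 * Real.arccos (x j)) := by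
      intro j
      have h := Polynomial.Chebyshev.T_real_cos (Real.arccos (x j)) 4
      have hj := hx j
      rw [Real.cos_arccos (by linarith [hj.1]) (by linarith [hj.2])] at h
      rw [chebT4, h]
      norm_num
    change meanT4.toSuperOp (fun j => rotX (Real.arccos (x j))) k 0 0 = _
    rw [meanT4_rotX (fun j => Real.arccos (x j)) k, ← hT, ← hT]
  · intro δ ε hδ hδ' hε hε'
    obtain ⟨m, hm, hmr, hmε⟩ := exists_degree hδ hδ' hε hε'
    obtain ⟨r, hrs, hrl, hrf, hre⟩ := exists_word_quarter_rotation hm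
    set κ := √(64 * (m : ℝ) ^ 2 * (1 - δ) ^ (2 * m)) with hκ
    have hκ0 : 0 ≤ κ := Real.sqrt_nonneg _
    set R : Circuit 1 1 := fun _ => r with hR
    have hRe : ∀ (U : Fin 1 → QubitOp) (k : Fin 1), R.toSuperOp U k = wordEval U r :=
      fun _ _ => rfl
    have hRg : IsGadget R.toSuperOp := by
      intro U hU k
      have h := fun j => isTwistedEmbeddable_iff.1 (hU j).isTwistedEmbeddable
      rw [hRe]
      exact isTwistedEmbeddable_iff.2
        ⟨hrs.wordEval_mem fun j => (h j).1, hrf U fun j => (h j).2⟩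
    have hdepth : (meanT4.comp (R.copies 2)).depth 0 ≤ 12 * (16 * m + 8) :=
      Circuit.depth_comp_le meanT4 (R.copies 2) (by omega)
        (fun j => by rw [Circuit.depth_copies]; exact hrl.le) 0
    -- As m ≥ 1, 12(16m+8) ≤ 288m ≤ 288 · 17 · rate = 4896 · rate.
    have hdepthR : ((meanT4.comp (R.copies 2)).depth 0 : ℝ) ≤ 5000 * rate δ ε := by
      have h1 : (((meanT4.comp (R.copies 2)).depth 0 : ℕ) : ℝ) ≤ ((12 * (16 * m + 8) : ℕ) : ℝ) :=
        Nat.cast_le.2 hdepth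
      have h2 : (1 : ℝ) ≤ m := by exact_mod_cast hm
      push_cast at h1
      linarith
    refine ⟨R, meanT4.comp (R.copies 2), hRg, ?_, rfl, ?_, ?_, ?_, hdepthR⟩
    · intro x hx k
      have h := (SU2.norm_entry_sub_le (hrs.wordEval_mem fun _ => rotX_mem_SU2 _)
        (rotX_mem_SU2 _)).trans (hre δ hδ.le hδ' (x 0) (hx 0))
      have hU : (fun j => rotX (Real.arccos (x j))) = fun _ : Fin 1 => rotX (Real.arccos (x 0)) := by
        funext j
        rw [Subsingleton.elim j 0]
      rw [achieved, hRe, hU]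
      exact h.trans (by linarith)
    · intro U hU k
      rw [Circuit.toSuperOp_comp]
      refine isTwistedEmbeddable_meanT4 (fun j => ?_) k
      rw [Circuit.toSuperOp_copies]
      exact hRg _ (fun _ => hU j) 0
    · intro x hx k
      have hV : ∀ j, (R.copies 2).toSuperOp (fun j => rotX (Real.arccos (x j))) j
          = wordEval (fun _ => rotX (Real.arccos (x j))) r := fun j => by
        rw [Circuit.toSuperOp_copies, hRe]
      have hVm : ∀ j, (R.copies 2).toSuperOp (fun j => rotX (Real.arccos (x j))) j ∈ SU2 := by
        intro j
        rw [hV]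
        exact hrs.wordEval_mem fun _ => rotX_mem_SU2 _
      have hWm : ∀ j : Fin 2, rotX (Real.arccos (x j) / 4) ∈ SU2 := fun j => rotX_mem_SU2 _
      -- The reference is the same word on the exact quarter rotations. Its 12 gates turn the oracle
      -- error 4κ into 48κ, the quantity bounded by ε in `exists_degree`.
      have hclose := isSpecialWord_meanT4Word.norm_wordEval_sub_le hVm hWm (η := 4 * κ)
        (fun j => by rw [hV]; exact hre δ hδ.le hδ' (x j) (hx j)) (by linarith)
      have hent := (SU2.norm_entry_sub_le (isSpecialWord_meanT4Word.wordEval_mem hVm)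
        (isSpecialWord_meanT4Word.wordEval_mem hWm)).trans hclose
      have hval : wordEval (fun j => rotX (Real.arccos (x j) / 4)) meanT4Word 0 0
          = (((x 0 + x 1) / 2 : ℝ) : ℂ) := by
        refine (meanT4_rotX (fun j => Real.arccos (x j) / 4) k).trans ?_
        have hc : ∀ j, Real.cos (4 * (Real.arccos (x j) / 4)) = x j := fun j => by
          rw [mul_div_cancel₀ _ (by norm_num : (4 : ℝ) ≠ 0)]
          exact Real.cos_arccos (by linarith [(hx j).1]) (by linarith [(hx j).2])
        rw [hc, hc]
      rw [hval] at hent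
      rw [achieved, Circuit.toSuperOp_comp]
      refine hent.trans ?_
      have hlen : (meanT4Word.length : ℝ) = 12 := by norm_num [meanT4Word]
      rw [hlen]
      linarith
    · exact (Nat.cast_le.2 (Circuit.cost_le_depth _ 0)).trans hdepthR
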